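/- Let $\alpha\in(\tfrac13,1)$, and let $D^\alpha$ be the Fourier multiplier $\widehat{D^\alpha f}(\xi)=|\xi|^\alpha\hat f(\xi)$ on $\mathbb R$. For $c>1$ consider real solutions $\psi\in H^{\alpha/2}(\mathbb R)$ of the solitary wave equation of the fractional BBM equation with speed $c$, $$D^\alpha\psi+\Big(1-\frac1c\Big)\psi-\frac1c\psi^2=0,\qquad(1)$$ and define the scaling $(T_c\psi)(x)=\frac1{c-1}\,\psi\big((\tfrac{c}{c-1})^{1/\alpha}x\big)$. (a) For every $c>1$, $\psi\in H^{\alpha/2}(\mathbb R)$ solves (1) if and only if $\Psi=T_c\psi\in H^{\alpha/2}(\mathbb R)$ solves $D^\alpha\Psi+\Psi-\Psi^2=0$. In that case $\psi\in H^\alpha(\mathbb R)$, and the momentum $M=\frac12\langle(D^\alpha+1)\psi,\psi\rangle_{L^2}$ satisfies $$2M=\Big[\frac{1}{3\alpha-1}c^{\frac1\alpha-1}(c-1)^{3-\frac1\alpha}+c^{\frac1\alpha}(c-1)^{2-\frac1\alpha}\Big]\|\Psi\|_{L^2}^2 .$$ (b) The number $c_0=\frac{2+\sqrt{2(3\alpha-1)}}{6\alpha}$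 is the larger root of $6\alpha^2c^2-4\alpha c+1-\alpha$, and $c_0>1$ if $\alpha<\frac12$. (c) Let $(\psi_c)_{c>1}$ be a family of solutions of (1) such that either all $T_c\psi_c$ are translates of one nonzero function $\Psi$, or every $\psi_c$ is a ground state, i.e. an even, positive solution of (1) which minimizes $$J(v)=\frac{\big(\int|D^{\alpha/2}v|^2\big)^{\frac1{2\alpha}}\big(\int|v|^2\big)^{\frac{\alpha-1}{2\alpha}+1}}{\int|v|^3}$$ over $H^{\alpha/2}(\mathbb R)\setminus\{0\}$. Then $M(c)=\frac12\langle(D^\alpha+1)\psi_c,\psi_c\rangle_{L^2}$ is differentiable on $(1,\infty)$, and $M'(c)>0$ for $\alpha\in[\frac12,1)$ and all $c>1$; $M'(c)>0$ for $\alpha\in(\frac13,\frac12)$ and $c>c_0$; $M'(c)<0$ for $\alpha\in(\frac13,\frac12)$ and $1<c<c_0$. -/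

import Mathlib

open MeasureTheory Set
open scoped FourierTransform SchwartzMap

noncomputable section

namespace FBBM

/-- The `L²` Fourier transform of a real function `u ∈ L²(ℝ)`, with Mathlib's normalization
`û(ξ) = ∫ u(x) exp(-2πixξ) dx`. It is only used for square integrable `u` (value `0` otherwise). -/
def fourierL2 (u : ℝ → ℝ) : ℝ → ℂ :=
  open Classical in
  if h : MemLp (fun x => (u x : ℂ)) 2 volume then ⇑(𝓕 (h.toLp _) : Lp ℂ 2 (volume : Measure ℝ))
  else 0

/-- The Fourier symbol of `D^s`: it is `|k|^s` in the frequency variable `k = 2πξ` dual to the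
convention `∫ u(x) exp(-ikx) dx`. -/
def symb (s ξ : ℝ) : ℝ := |2 * Real.pi * ξ| ^ s

/-- The function `D^s u`, the inverse `L²` Fourier transform of `|2πξ|^s û(ξ)`. It is only used where
this product is square integrable, that is for `u ∈ H^s(ℝ)` with `s > 0` (value `0` otherwise). -/
def fracD (s : ℝ) (u : ℝ → ℝ) : ℝ → ℂ :=
  open Classical in
  if h : MemLp (fun ξ => (symb s ξ : ℂ) * fourierL2 u ξ) 2 volume then
    ⇑(𝓕⁻ (h.toLp _) : Lp ℂ 2 (volume : Measure ℝ))
  else 0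

/-- `u ∈ H^s(ℝ)` for a real function `u ∈ L²(ℝ)`. -/
def MemH (s : ℝ) (u : ℝ → ℝ) : Prop :=
  ∃ h : MemLp (fun x => (u x : ℂ)) 2 volume,
    TemperedDistribution.MemSobolev s 2 ((h.toLp _ : Lp ℂ 2 (volume : Measure ℝ)) : 𝓢'(ℝ, ℂ))

/-- `u ∈ H^{α/2}(ℝ)` is a (distributional) solution of `D^α u + ω u - κ u² = 0`. The equation is
written on the Fourier side; since `u ∈ L²`, the function `u²` is integrable and its Fourier
transform is the usual integral. -/
def Solves (α ω κ : ℝ) (u : ℝ → ℝ) : Prop :=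
  MemH (α / 2) u ∧
    ∀ᵐ ξ : ℝ, (symb α ξ : ℂ) * fourierL2 u ξ + (ω : ℂ) * fourierL2 u ξ
      - (κ : ℂ) * 𝓕 (fun x : ℝ => ((u x ^ 2 : ℝ) : ℂ)) ξ = 0

/-- Profiles of solitary waves of the fBBM equation with speed `c`:
`D^α ψ + (1 - 1/c) ψ - (1/c) ψ² = 0`. -/
def IsProfile (α c : ℝ) (ψ : ℝ → ℝ) : Prop := Solves α (1 - 1 / c) (1 / c) ψ

/-- The scaling `Ψ(x) = a ψ(b x)` with `a = 1/(c-1)` and `b = (c/(c-1))^{1/α}`. -/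
def rescale (α c : ℝ) (ψ : ℝ → ℝ) : ℝ → ℝ :=
  fun x => 1 / (c - 1) * ψ ((c / (c - 1)) ^ (1 / α) * x)

/-- The momentum `½ ⟨(D^α + 1) u, u⟩` of a real function `u`, with the `L²` inner product. -/
def momentum (α : ℝ) (u : ℝ → ℝ) : ℝ :=
  1 / 2 * (∫ x, (fracD α u x + (u x : ℂ)) * (u x : ℂ)).re

/-- The Weinstein functional `J^{α,p}` with `p = 1`. -/
def weinstein (α : ℝ) (v : ℝ → ℝ) : ℝ :=
  (∫ x, ‖fracD (α / 2) v x‖ ^ 2) ^ (1 / (2 * α)) *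
    (∫ x, |v x| ^ 2) ^ (1 / (2 * α) * (α - 1) + 1) / ∫ x, |v x| ^ 3

/-- Ground state profiles with speed `c`: even positive solutions in `H^{α/2}` which minimize the
Weinstein functional over `H^{α/2} \ {0}`. -/
def IsGroundState (α c : ℝ) (φ : ℝ → ℝ) : Prop :=
  IsProfile α c φ ∧ (∀ᵐ x : ℝ, φ (-x) = φ x) ∧ (∀ᵐ x : ℝ, 0 < φ x) ∧
    ∀ v : ℝ → ℝ, MemH (α / 2) v → ¬ (∀ᵐ x : ℝ, v x = 0) → weinstein α φ ≤ weinstein α v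

/-- The threshold speed. -/
def c₀ (α : ℝ) : ℝ := (2 + √(2 * (3 * α - 1))) / (6 * α)

/-- `M` is differentiable on `(1, ∞)` and its derivative has the following signs. -/
def HasMomentumSigns (α : ℝ) (M : ℝ → ℝ) : Prop :=
  (∀ c, 1 < c → DifferentiableAt ℝ M c) ∧
  (1 / 2 ≤ α → ∀ c, 1 < c → 0 < deriv M c) ∧
  (α < 1 / 2 → ∀ c, c₀ α < c → 0 < deriv M c) ∧
  (α < 1 / 2 → ∀ c, 1 < c → c < c₀ α → deriv M c < 0)

end FBBM

end

/-!
On the Fourier side the equation reads `(|2πξ|^α + ω) û = κ û ⋆ û`. Feeding the decay of `û` back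
into the convolution improves it by a fixed amount each time, precisely because `α > 1/3`, until
`û` is integrable with a weight and `u` is bounded, Lipschitz and vanishing at infinity.

Pohozaev's identity is obtained without differentiating `u`. Comparing `u` with its dilations
`u(l ·)`, the integral of `(u(l ·) - u)³` can be computed from the symmetry of `D^α`, and it is
`o(l - 1)` as `l → 1`: monotonicity of `D^α` together with the smallness of `u` at infinity shows
that the integral of `(u(l ·) - u)²` is. Together with the energy identity it expresses
`‖D^{α/2} u‖²`, hence the momentum, as a multiple of `‖u‖²`.

For the two kinds of families the rescaled profiles have the same mass for all speeds. For ground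
states this holds because `J` is invariant under scaling, so that all of them have the same minimal
value of `J`, which for the rescaled profile is a constant multiple of `‖Ψ‖`. The derivative of the
remaining factor is a positive multiple of `6 α² c² - 4 α c + 1 - α`.
-/

/-! ### The Fourier transform on `L²` -/

noncomputable section

namespace FBBM

open Complex Filter

variable {V : Type*} [NormedAddCommGroup V] [InnerProductSpace ℝ V] [FiniteDimensional ℝ V]
  [MeasurableSpace V] [BorelSpace V]

/-- `g` is a representative of the `L²` Fourier transform of `f ∈ L²(V)`. Working with this relation
instead of elements of `Lp` keeps pointwise computations with functions possible. -/
def IsFT (f g : V → ℂ) : Prop :=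
  ∃ h : MemLp f 2 volume, ⇑(𝓕 (h.toLp f) : Lp ℂ 2 (volume : Measure V)) =ᵐ[volume] g

lemma ae_eq_of_integral_schwartz {f g : V → ℂ} (hf : LocallyIntegrable f)
    (hg : LocallyIntegrable g) (h : ∀ φ : 𝓢(V, ℂ), ∫ x, φ x * f x = ∫ x, φ x * g x) :
    f =ᵐ[volume] g := by
  refine ae_eq_of_integral_contDiff_smul_eq hf hg fun φ hφ hc => ?_
  have hc' : HasCompactSupport (ofRealCLM ∘ φ) := hc.comp_left rfl
  exact h (hc'.toSchwartzMap (ofRealCLM.contDiff.comp hφ))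

lemma continuous_fourier {f : V → ℂ} (hf : Integrable f) : Continuous (𝓕 f) :=
  VectorFourier.fourierIntegral_continuous Real.continuous_fourierChar
    (by exact continuous_inner) hf

lemma continuous_fourierInv {f : V → ℂ} (hf : Integrable f) : Continuous (𝓕⁻ f) := by
  rw [funext (Real.fourierInv_eq_fourier_neg f)]
  exact (continuous_fourier hf).comp continuous_neg

lemma integral_schwartz_mul_fourier (φ : 𝓢(V, ℂ)) {f : V → ℂ} (hf : Integrable f) :
    ∫ x, φ x * 𝓕 f x = ∫ x, 𝓕 φ x * f x := by
  have h := VectorFourier.integral_fourierIntegral_smul_eq_flip (L := innerₗ V)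
    (μ := volume) (ν := volume) (f := (φ : V → ℂ)) Real.continuous_fourierChar
    (by exact continuous_inner) φ.integrable hf
  simp only [flip_innerₗ, smul_eq_mul] at h
  exact h.symm

lemma integral_schwartz_mul_fourierInv (φ : 𝓢(V, ℂ)) {g : V → ℂ} (hg : Integrable g) :
    ∫ x, φ x * 𝓕⁻ g x = ∫ x, 𝓕⁻ φ x * g x := by
  simp only [Real.fourierInv_eq_fourier_comp_neg]
  rw [integral_schwartz_mul_fourier φ hg.comp_neg, ← integral_neg_eq_self]
  simp only [neg_neg, SchwartzMap.fourier_coe, SchwartzMap.fourierInv_coe,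
    Real.fourierInv_eq_fourier_neg]

namespace IsFT

variable {f f' g g' : V → ℂ}

lemma memLp_left (h : IsFT f g) : MemLp f 2 volume := h.1

lemma memLp_right (h : IsFT f g) : MemLp g 2 volume := (Lp.memLp _).ae_eq h.2

lemma toLp_eq (h : IsFT f g) :
    (𝓕 (h.memLp_left.toLp f) : Lp ℂ 2 (volume : Measure V)) = h.memLp_right.toLp g :=
  Lp.ext (h.2.trans (MemLp.coeFn_toLp _).symm)

lemma of_memLp (h : MemLp f 2 volume) :
    IsFT f ⇑(𝓕 (h.toLp f) : Lp ℂ 2 (volume : Measure V)) := ⟨h, EventuallyEq.rfl⟩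

lemma unique (h : IsFT f g) (h' : IsFT f g') : g =ᵐ[volume] g' := h.2.symm.trans h'.2

lemma unique_left (h : IsFT f g) (h' : IsFT f' g) : f =ᵐ[volume] f' := by
  have htoLp : h.memLp_left.toLp f = h'.memLp_left.toLp f' :=
    (Lp.fourierTransformₗᵢ V ℂ).injective (h.toLp_eq.trans h'.toLp_eq.symm)
  exact (MemLp.toLp_eq_toLp_iff _ _).1 htoLp

lemma congr (h : IsFT f g) (hf : f =ᵐ[volume] f') (hg : g =ᵐ[volume] g') : IsFT f' g' := by
  refine ⟨h.memLp_left.ae_eq hf, ?_⟩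
  rw [← MemLp.toLp_congr h.memLp_left _ hf]
  exact h.2.trans hg

lemma const_mul (c : ℂ) (h : IsFT f g) : IsFT (fun x => c * f x) (fun x => c * g x) := by
  refine ⟨h.memLp_left.const_mul c, ?_⟩
  have hc : (h.memLp_left.const_mul c).toLp _ = c • h.memLp_left.toLp f :=
    MemLp.toLp_const_smul c h.memLp_left
  rw [hc, FourierTransform.fourier_smul, h.toLp_eq, ← MemLp.toLp_const_smul]
  exact MemLp.coeFn_toLp _

lemma sub (h : IsFT f g) (h' : IsFT f' g') :
    IsFT (fun x => f x - f' x) (fun x => g x - g' x) := by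
  refine ⟨h.memLp_left.sub h'.memLp_left, ?_⟩
  have hsub : (𝓕 ((h.memLp_left.sub h'.memLp_left).toLp _) : Lp ℂ 2 (volume : Measure V))
      = (h.memLp_right.sub h'.memLp_right).toLp _ := by
    rw [MemLp.toLp_sub h.memLp_left h'.memLp_left, MemLp.toLp_sub h.memLp_right h'.memLp_right,
      ← h.toLp_eq, ← h'.toLp_eq]
    exact (Lp.fourierTransformₗᵢ V ℂ).map_sub _ _
  exact hsub ▸ MemLp.coeFn_toLp (h.memLp_right.sub h'.memLp_right)

lemma integral_conj_mul (h : IsFT f g) (h' : IsFT f' g') :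
    ∫ x, f' x * (starRingEnd ℂ) (f x) = ∫ x, g' x * (starRingEnd ℂ) (g x) := by
  have inner_toLp : ∀ {u v : V → ℂ} (hu : MemLp u 2 volume) (hv : MemLp v 2 volume),
      inner ℂ (hu.toLp u) (hv.toLp v) = ∫ x, v x * (starRingEnd ℂ) (u x) := fun hu hv => by
    rw [L2.inner_def]
    refine integral_congr_ae ?_
    filter_upwards [hu.coeFn_toLp, hv.coeFn_toLp] with x hx hx'
    rw [hx, hx']
    rfl
  rw [← inner_toLp h.memLp_left h'.memLp_left, ← Lp.inner_fourier_eq, h.toLp_eq, h'.toLp_eq,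
    inner_toLp]

lemma integral_schwartz (h : IsFT f g) (φ : 𝓢(V, ℂ)) :
    ∫ x, φ x * g x = ∫ x, 𝓕 φ x * f x := by
  have toTempered_toLp : ∀ {u : V → ℂ} (hu : MemLp u 2 volume) (η : 𝓢(V, ℂ)),
      ((hu.toLp u : Lp ℂ 2 (volume : Measure V)) : 𝓢'(V, ℂ)) η = ∫ x, η x * u x := fun hu η => by
    rw [Lp.toTemperedDistribution_apply]
    refine integral_congr_ae ?_
    filter_upwards [hu.coeFn_toLp] with x hx
    rw [hx]
    rfl
  rw [← toTempered_toLp h.memLp_right, ← h.toLp_eq, ← toTempered_toLp h.memLp_left,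
    ← TemperedDistribution.fourier_apply, Lp.fourier_toTemperedDistribution_eq]

lemma of_integral_schwartz (hf : MemLp f 2 volume) (hg : LocallyIntegrable g)
    (h : ∀ φ : 𝓢(V, ℂ), ∫ x, φ x * g x = ∫ x, 𝓕 φ x * f x) : IsFT f g := by
  refine ⟨hf, ae_eq_of_integral_schwartz ((Lp.memLp _).locallyIntegrable (by norm_num)) hg
    fun φ => ?_⟩
  rw [(of_memLp hf).integral_schwartz, h]

lemma of_integrable (hf : MemLp f 2 volume) (hi : Integrable f) : IsFT f (𝓕 f) :=
  of_integral_schwartz hf (continuous_fourier hi).locallyIntegrable fun φ =>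
    integral_schwartz_mul_fourier φ hi

lemma ae_eq_fourierInv (h : IsFT f g) (hg : Integrable g) : f =ᵐ[volume] 𝓕⁻ g := by
  refine ae_eq_of_integral_schwartz (h.memLp_left.locallyIntegrable (by norm_num))
    (continuous_fourierInv hg).locallyIntegrable fun φ => ?_
  rw [integral_schwartz_mul_fourierInv φ hg, h.integral_schwartz,
    FourierTransform.fourier_fourierInv_eq]

end IsFT

lemma integral_inv_mul_comp {b : ℝ} (hb : 0 < b) (F : ℝ → ℂ) :
    ∫ x, (b : ℂ)⁻¹ * F (b⁻¹ * x) = ∫ x, F x := by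
  rw [integral_const_mul, Measure.integral_comp_mul_left F b⁻¹]
  simp [abs_of_pos hb, hb.ne']

lemma fourier_comp_mul {b : ℝ} (hb : 0 < b) (f : ℝ → ℂ) (ξ : ℝ) :
    𝓕 (fun x => f (b * x)) ξ = (b : ℂ)⁻¹ * 𝓕 f (b⁻¹ * ξ) := by
  rw [Real.fourier_real_eq_integral_exp_smul, Real.fourier_real_eq_integral_exp_smul,
    ← integral_inv_mul_comp hb, integral_const_mul]
  congr 2 with x
  rw [mul_inv_cancel_left₀ hb.ne',
    show -2 * Real.pi * (b⁻¹ * x) * ξ = -2 * Real.pi * x * (b⁻¹ * ξ) by ring]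

lemma memLp_comp_mul {E : Type*} [NormedAddCommGroup E] {f : ℝ → E} {p : ENNReal} {b : ℝ}
    (hb : b ≠ 0) (h : MemLp f p volume) : MemLp (fun x => f (b * x)) p volume := by
  have hmap : MemLp f p (Measure.map (b * ·) volume) := by
    rw [Real.map_volume_mul_left hb]
    exact h.smul_measure ENNReal.ofReal_ne_top
  exact hmap.comp_of_map (by fun_prop)

namespace IsFT

variable {f g : ℝ → ℂ}

lemma comp_mul {b : ℝ} (hb : 0 < b) (h : IsFT f g) :
    IsFT (fun x => f (b * x)) (fun ξ => (b : ℂ)⁻¹ * g (b⁻¹ * ξ)) := by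
  have hb' : b⁻¹ ≠ 0 := inv_ne_zero hb.ne'
  refine of_integral_schwartz (memLp_comp_mul hb.ne' h.memLp_left)
    (((memLp_comp_mul hb' h.memLp_right).const_mul _).locallyIntegrable (by norm_num)) fun φ => ?_
  let e : ℝ ≃L[ℝ] ℝ := ContinuousLinearEquiv.unitsEquivAut ℝ (Units.mk0 b hb.ne')
  let φb : 𝓢(ℝ, ℂ) := SchwartzMap.compCLMOfContinuousLinearEquiv ℂ e φ
  have hφb : (φb : ℝ → ℂ) = fun x => φ (b * x) := funext fun x => congrArg φ (mul_comm x b)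
  have fourier_φb : ∀ x, 𝓕 φb x = (b : ℂ)⁻¹ * 𝓕 φ (b⁻¹ * x) := fun x => by
    rw [SchwartzMap.fourier_coe, hφb, fourier_comp_mul hb, SchwartzMap.fourier_coe]
  calc ∫ x, φ x * ((b : ℂ)⁻¹ * g (b⁻¹ * x))
      = ∫ x, (b : ℂ)⁻¹ * (φ (b * (b⁻¹ * x)) * g (b⁻¹ * x)) := by
        simp only [mul_inv_cancel_left₀ hb.ne', mul_left_comm]
    _ = ∫ x, φb x * g x := by rw [integral_inv_mul_comp hb fun x => φ (b * x) * g x, hφb]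
    _ = ∫ x, 𝓕 φb x * f x := h.integral_schwartz φb
    _ = ∫ x, (b : ℂ)⁻¹ * (𝓕 φ (b⁻¹ * x) * f (b * (b⁻¹ * x))) := by
        simp only [fourier_φb, mul_inv_cancel_left₀ hb.ne', mul_assoc]
    _ = ∫ x, 𝓕 φ x * f (b * x) := integral_inv_mul_comp hb fun x => 𝓕 φ x * f (b * x)

lemma modulate (a : ℝ) (h : IsFT f g) :
    IsFT (fun x : ℝ => cexp (2 * Real.pi * a * x * I) * f x) (fun ξ => g (ξ - a)) := by
  have norm_exp : ∀ x : ℝ, ‖cexp (2 * Real.pi * a * x * I)‖ = 1 := fun x => by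
    exact_mod_cast Complex.norm_exp_ofReal_mul_I (2 * Real.pi * a * x)
  have hf : MemLp (fun x : ℝ => cexp (2 * Real.pi * a * x * I) * f x) 2 volume :=
    h.memLp_left.of_le (AEStronglyMeasurable.mul (by fun_prop) h.memLp_left.1)
      (.of_forall fun x => by rw [norm_mul, norm_exp, one_mul])
  refine of_integral_schwartz hf ((h.memLp_right.comp_measurePreserving
    (measurePreserving_sub_right volume a)).locallyIntegrable (by norm_num)) fun φ => ?_
  let ψ : 𝓢(ℝ, ℂ) := SchwartzMap.compSubConstCLM ℂ (-a) φ
  have hψ : ∀ x, ψ x = φ (x + a) := fun x => by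
    rw [SchwartzMap.compSubConstCLM_apply, sub_neg_eq_add]
  have fourier_ψ : ∀ x, 𝓕 ψ x = 𝓕 φ x * cexp (2 * Real.pi * a * x * I) := fun x => by
    simp only [SchwartzMap.fourier_coe, Real.fourier_real_eq_integral_exp_smul]
    rw [← integral_mul_const,
      ← integral_sub_right_eq_self (fun y => cexp (_ * I) • ψ y) a]
    congr 1 with y
    rw [hψ, sub_add_cancel, smul_eq_mul, smul_eq_mul, mul_right_comm (cexp _) (φ y),
      ← Complex.exp_add]
    push_cast
    ring_nf
  calc ∫ x, φ x * g (x - a) = ∫ x, ψ x * g x := by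
        rw [← integral_sub_right_eq_self (fun x => ψ x * g x) a]
        simp only [hψ, sub_add_cancel]
    _ = ∫ x, 𝓕 ψ x * f x := h.integral_schwartz ψ
    _ = ∫ x, 𝓕 φ x * (cexp (2 * Real.pi * a * x * I) * f x) := by simp only [fourier_ψ, mul_assoc]

end IsFT

/-! ### Fractional derivatives -/

lemma isFT_fourierL2 {u : ℝ → ℝ} (h : MemLp (fun x => (u x : ℂ)) 2 volume) :
    IsFT (fun x => (u x : ℂ)) (fourierL2 u) := by
  rw [fourierL2, dif_pos h]
  exact IsFT.of_memLp h

lemma measurable_fourierL2 (u : ℝ → ℝ) : Measurable (fourierL2 u) := by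
  rw [fourierL2]
  split_ifs
  · exact (Lp.stronglyMeasurable _).measurable
  · exact measurable_zero

lemma symb_nonneg (s ξ : ℝ) : 0 ≤ symb s ξ := Real.rpow_nonneg (abs_nonneg _) s

lemma measurable_symb (s : ℝ) : Measurable (symb s) := by
  unfold symb
  fun_prop

lemma symb_mul {b : ℝ} (hb : 0 < b) (s ξ : ℝ) : symb s (b * ξ) = b ^ s * symb s ξ := by
  rw [symb, symb, ← Real.mul_rpow hb.le (abs_nonneg _), mul_left_comm, abs_mul b, abs_of_pos hb]

lemma symb_half_sq {s : ℝ} (hs : 0 ≤ s) (ξ : ℝ) : symb (s / 2) ξ ^ 2 = symb s ξ := by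
  rw [symb, symb, sq, ← Real.rpow_add_of_nonneg (abs_nonneg _) (by linarith) (by linarith),
    add_halves]

lemma one_add_abs_rpow_le {s : ℝ} (hs : 0 ≤ s) (ξ : ℝ) :
    (1 + |ξ|) ^ s ≤ 2 ^ s * (1 + symb s ξ) := by
  have hξ := abs_nonneg ξ
  have hsymb := symb_nonneg s ξ
  rcases le_total |ξ| 1 with h | h
  · calc (1 + |ξ|) ^ s ≤ 2 ^ s := Real.rpow_le_rpow (by positivity) (by linarith) hs
      _ ≤ 2 ^ s * (1 + symb s ξ) := le_mul_of_one_le_right (by positivity) (by linarith)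
  · calc (1 + |ξ|) ^ s ≤ (2 * |2 * Real.pi * ξ|) ^ s := by
          refine Real.rpow_le_rpow (by positivity) ?_ hs
          rw [abs_mul, abs_of_pos Real.two_pi_pos]
          nlinarith [Real.pi_gt_three]
      _ = 2 ^ s * symb s ξ := Real.mul_rpow (by norm_num) (abs_nonneg _)
      _ ≤ 2 ^ s * (1 + symb s ξ) := by gcongr; linarith

lemma symb_le_japanese {s : ℝ} (hs : 0 ≤ s) (ξ : ℝ) :
    symb s ξ ≤ (2 * Real.pi) ^ s * (1 + ‖ξ‖ ^ 2) ^ (s / 2) := by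
  have hξ : |ξ| ≤ √(1 + ‖ξ‖ ^ 2) := Real.abs_le_sqrt (by simp)
  rw [div_eq_inv_mul, ← one_div, Real.rpow_mul (by positivity), ← Real.sqrt_eq_rpow,
    ← Real.mul_rpow (by positivity) (by positivity)]
  refine Real.rpow_le_rpow (abs_nonneg _) ?_ hs
  rw [abs_mul, abs_of_pos Real.two_pi_pos]
  gcongr

lemma japanese_le_one_add_abs_rpow {s : ℝ} (hs : 0 ≤ s) (ξ : ℝ) :
    (1 + ‖ξ‖ ^ 2) ^ (s / 2) ≤ (1 + |ξ|) ^ s := by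
  have hξ : √(1 + ‖ξ‖ ^ 2) ≤ 1 + |ξ| := by
    rw [Real.norm_eq_abs, Real.sqrt_le_left (by positivity)]
    nlinarith [abs_nonneg ξ]
  rw [div_eq_inv_mul, ← one_div, Real.rpow_mul (by positivity), ← Real.sqrt_eq_rpow]
  exact Real.rpow_le_rpow (Real.sqrt_nonneg _) hξ hs

lemma memLp_ofReal_mul_of_le {p : ENNReal} {v w : ℝ → ℝ} {g : ℝ → ℂ} {C : ℝ} (hv : Measurable v)
    (hg : AEStronglyMeasurable g) (h : MemLp (fun ξ => (w ξ : ℂ) * g ξ) p volume)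
    (hvw : ∀ ξ, |v ξ| ≤ C * |w ξ|) : MemLp (fun ξ => (v ξ : ℂ) * g ξ) p volume := by
  refine h.of_le_mul (c := C) ((measurable_ofReal.comp hv).aestronglyMeasurable.mul hg)
    (.of_forall fun ξ => ?_)
  rw [norm_mul, norm_mul, norm_real, norm_real, ← mul_assoc]
  exact mul_le_mul_of_nonneg_right (hvw ξ) (norm_nonneg _)

lemma memLp_one_add_abs_rpow_mul {s : ℝ} (hs : 0 ≤ s) {g : ℝ → ℂ} (hg : MemLp g 2 volume)
    (h : MemLp (fun ξ => (symb s ξ : ℂ) * g ξ) 2 volume) :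
    MemLp (fun ξ => (((1 + |ξ|) ^ s : ℝ) : ℂ) * g ξ) 2 volume := by
  have hsum : MemLp (fun ξ => ((1 + symb s ξ : ℝ) : ℂ) * g ξ) 2 volume := by
    refine (hg.add h).ae_eq (.of_forall fun ξ => ?_)
    push_cast
    exact (one_add_mul _ _).symm
  refine memLp_ofReal_mul_of_le (C := 2 ^ s) (by fun_prop) hg.1 hsum fun ξ => ?_
  rw [abs_of_nonneg (by positivity : 0 ≤ (1 + |ξ|) ^ s),
    abs_of_nonneg (add_nonneg zero_le_one (symb_nonneg s ξ))]
  exact one_add_abs_rpow_le hs ξ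

lemma smulLeftCLM_fourier_apply {s : ℝ} {f g : ℝ → ℂ} (h : IsFT f g) (φ : 𝓢(ℝ, ℂ)) :
    TemperedDistribution.smulLeftCLM ℂ (fun ξ : ℝ => (((1 + ‖ξ‖ ^ 2) ^ (s / 2) : ℝ) : ℂ))
      (𝓕 ((h.memLp_left.toLp f : Lp ℂ 2 (volume : Measure ℝ)) : 𝓢'(ℝ, ℂ))) φ =
      ∫ ξ, φ ξ * ((((1 + ‖ξ‖ ^ 2) ^ (s / 2) : ℝ) : ℂ) * g ξ) := by
  have hw : Function.HasTemperateGrowth (fun ξ : ℝ => (((1 + ‖ξ‖ ^ 2) ^ (s / 2) : ℝ) : ℂ)) := by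
    fun_prop
  rw [Lp.fourier_toTemperedDistribution_eq, h.toLp_eq,
    TemperedDistribution.smulLeftCLM_apply_apply, Lp.toTemperedDistribution_apply]
  refine integral_congr_ae ?_
  filter_upwards [h.memLp_right.coeFn_toLp] with ξ hξ
  rw [hξ, SchwartzMap.smulLeftCLM_apply_apply hw, smul_eq_mul, smul_eq_mul]
  ring

lemma memSobolev_iff {s : ℝ} {f g : ℝ → ℂ} (h : IsFT f g) :
    TemperedDistribution.MemSobolev s 2
      ((h.memLp_left.toLp f : Lp ℂ 2 (volume : Measure ℝ)) : 𝓢'(ℝ, ℂ)) ↔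
      MemLp (fun ξ => (((1 + ‖ξ‖ ^ 2) ^ (s / 2) : ℝ) : ℂ) * g ξ) 2 volume := by
  rw [TemperedDistribution.memSobolev_iff_exists_smulLeftCLM_fourier]
  constructor
  · rintro ⟨f', hf'⟩
    have hw : Function.HasTemperateGrowth (fun ξ : ℝ => (((1 + ‖ξ‖ ^ 2) ^ (s / 2) : ℝ) : ℂ)) := by
      fun_prop
    refine (Lp.memLp f').ae_eq (ae_eq_of_integral_schwartz
      ((Lp.memLp f').locallyIntegrable (by norm_num)) ?_ fun φ => ?_)
    · rw [← locallyIntegrableOn_univ]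
      exact LocallyIntegrableOn.continuousOn_mul
        ((h.memLp_right.locallyIntegrable (by norm_num)).locallyIntegrableOn _)
        hw.1.continuous.continuousOn isOpen_univ.isLocallyClosed
    · rw [← smulLeftCLM_fourier_apply h, hf', Lp.toTemperedDistribution_apply]
      rfl
  · intro hg
    refine ⟨hg.toLp _, ?_⟩
    ext φ
    rw [smulLeftCLM_fourier_apply h, Lp.toTemperedDistribution_apply]
    refine integral_congr_ae ?_
    filter_upwards [hg.coeFn_toLp] with ξ hξ
    rw [hξ]
    rfl

lemma memH_iff {s : ℝ} (hs : 0 ≤ s) {u : ℝ → ℝ} {g : ℝ → ℂ}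
    (h : IsFT (fun x => (u x : ℂ)) g) :
    MemH s u ↔ MemLp (fun ξ => (symb s ξ : ℂ) * g ξ) 2 volume := by
  have hMemH : MemH s u ↔ MemLp (fun ξ => (((1 + ‖ξ‖ ^ 2) ^ (s / 2) : ℝ) : ℂ) * g ξ) 2 volume := by
    rw [← memSobolev_iff h]
    exact ⟨fun ⟨_, hu⟩ => hu, fun hu => ⟨h.memLp_left, hu⟩⟩
  rw [hMemH]
  constructor <;> intro hg
  · refine memLp_ofReal_mul_of_le (C := (2 * Real.pi) ^ s) (measurable_symb s) h.memLp_right.1 hg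
      fun ξ => ?_
    rw [abs_of_nonneg (symb_nonneg s ξ), abs_of_nonneg (by positivity)]
    exact symb_le_japanese hs ξ
  · refine memLp_ofReal_mul_of_le (C := 1) (by fun_prop) h.memLp_right.1
      (memLp_one_add_abs_rpow_mul hs h.memLp_right hg) fun ξ => ?_
    rw [one_mul, abs_of_nonneg (by positivity), abs_of_nonneg (by positivity)]
    exact japanese_le_one_add_abs_rpow hs ξ

/-- `h` is a representative of `D^s f ∈ L²(ℝ)`, for `f ∈ L²(ℝ)`. This is the relational version of
`fracD` for complex valued functions, and carries the information that `f ∈ H^s(ℝ)`. -/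
def HasFracD (s : ℝ) (f h : ℝ → ℂ) : Prop :=
  ∃ g, IsFT f g ∧ IsFT h (fun ξ => (symb s ξ : ℂ) * g ξ)

lemma hasFracD_fracD {s : ℝ} (hs : 0 ≤ s) {u : ℝ → ℝ} (h : MemH s u) :
    HasFracD s (fun x => (u x : ℂ)) (fracD s u) := by
  have hu := isFT_fourierL2 h.1
  have hL2 := (memH_iff hs hu).1 h
  refine ⟨_, hu, ?_⟩
  rw [fracD, dif_pos hL2]
  refine (IsFT.of_memLp (Lp.memLp _)).congr EventuallyEq.rfl ?_
  rw [Lp.toLp_coeFn, FourierTransform.fourier_fourierInv_eq]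
  exact hL2.coeFn_toLp

namespace HasFracD

variable {s : ℝ} {f f' h h' : ℝ → ℂ}

lemma memH (hs : 0 ≤ s) {u : ℝ → ℝ} (hu : HasFracD s (fun x => (u x : ℂ)) h) : MemH s u := by
  obtain ⟨g, hug, hg⟩ := hu
  exact (memH_iff hs hug).2 hg.memLp_right

lemma unique (hf : HasFracD s f h) (hf' : HasFracD s f h') : h =ᵐ[volume] h' := by
  obtain ⟨g, hg, hsg⟩ := hf
  obtain ⟨g', hg', hsg'⟩ := hf'
  refine hsg.unique_left (hsg'.congr EventuallyEq.rfl ?_)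
  filter_upwards [hg.unique hg'] with ξ hξ
  rw [hξ]

lemma const_mul (c : ℂ) (hf : HasFracD s f h) :
    HasFracD s (fun x => c * f x) (fun x => c * h x) := by
  obtain ⟨g, hg, hsg⟩ := hf
  exact ⟨_, hg.const_mul c, by simpa only [mul_left_comm] using hsg.const_mul c⟩

lemma sub (hf : HasFracD s f h) (hf' : HasFracD s f' h') :
    HasFracD s (fun x => f x - f' x) (fun x => h x - h' x) := by
  obtain ⟨g, hg, hsg⟩ := hf
  obtain ⟨g', hg', hsg'⟩ := hf'
  exact ⟨_, hg.sub hg', by simpa only [mul_sub] using hsg.sub hsg'⟩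

lemma comp_mul {b : ℝ} (hb : 0 < b) (hf : HasFracD s f h) :
    HasFracD s (fun x => f (b * x)) (fun x => ((b ^ s : ℝ) : ℂ) * h (b * x)) := by
  obtain ⟨g, hg, hsg⟩ := hf
  refine ⟨_, hg.comp_mul hb, ((hsg.comp_mul hb).const_mul _).congr EventuallyEq.rfl
    (.of_forall fun ξ => ?_)⟩
  have hsymb : symb s ξ = b ^ s * symb s (b⁻¹ * ξ) := by
    rw [← symb_mul hb, mul_inv_cancel_left₀ hb.ne']
  simp only [hsymb, ofReal_mul]
  ring

lemma integral_mul_conj_comm (hf : HasFracD s f h) (hf' : HasFracD s f' h') :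
    ∫ x, h' x * (starRingEnd ℂ) (f x) = ∫ x, f' x * (starRingEnd ℂ) (h x) := by
  obtain ⟨g, hg, hsg⟩ := hf
  obtain ⟨g', hg', hsg'⟩ := hf'
  rw [hg.integral_conj_mul hsg', hsg.integral_conj_mul hg']
  simp only [map_mul, conj_ofReal]
  congr 1 with ξ
  ring

lemma integral_mul_conj_half (hs : 0 ≤ s) (hf : HasFracD s f h) (hf' : HasFracD (s / 2) f h') :
    ∫ x, h x * (starRingEnd ℂ) (f x) = ((∫ x, ‖h' x‖ ^ 2 : ℝ) : ℂ) := by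
  obtain ⟨g, hg, hsg⟩ := hf
  obtain ⟨g', hg', hsg'⟩ := hf'
  have hnorm : ((∫ x, ‖h' x‖ ^ 2 : ℝ) : ℂ) = ∫ x, h' x * (starRingEnd ℂ) (h' x) := by
    rw [← integral_complex_ofReal]
    simp only [mul_conj, normSq_eq_norm_sq]
  rw [hnorm, hg.integral_conj_mul hsg, hsg'.integral_conj_mul hsg']
  refine integral_congr_ae ?_
  filter_upwards [hg.unique hg'] with ξ hξ
  simp only [map_mul, conj_ofReal, hξ, ← symb_half_sq hs ξ]
  push_cast
  ring

end HasFracD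

lemma MemH.const_mul_comp_mul {s : ℝ} (hs : 0 ≤ s) (a : ℝ) {b : ℝ} (hb : 0 < b) {u : ℝ → ℝ}
    (h : MemH s u) : MemH s (fun x => a * u (b * x)) := by
  have hD := ((hasFracD_fracD hs h).comp_mul hb).const_mul (a : ℂ)
  simp only [← ofReal_mul a] at hD
  exact hD.memH hs

lemma integral_norm_fracD_sq_const_mul_comp_mul {s : ℝ} (hs : 0 ≤ s) (a : ℝ) {b : ℝ} (hb : 0 < b)
    {u : ℝ → ℝ} (h : MemH s u) :
    ∫ x, ‖fracD s (fun x => a * u (b * x)) x‖ ^ 2 =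
      a ^ 2 * (b ^ s) ^ 2 * (b⁻¹ * ∫ x, ‖fracD s u x‖ ^ 2) := by
  have hD := ((hasFracD_fracD hs h).comp_mul hb).const_mul (a : ℂ)
  have hD' := hasFracD_fracD hs (h.const_mul_comp_mul hs a hb)
  simp only [← ofReal_mul a] at hD
  have hscale := Measure.integral_comp_mul_left (fun x => ‖fracD s u x‖ ^ 2) b
  rw [abs_of_pos (inv_pos.2 hb), smul_eq_mul] at hscale
  rw [← hscale, ← integral_const_mul]
  refine integral_congr_ae ?_
  filter_upwards [hD'.unique hD] with x hx
  rw [hx, norm_mul, norm_mul, norm_real, norm_real, mul_pow, mul_pow,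
    Real.norm_eq_abs, Real.norm_eq_abs, sq_abs, sq_abs, mul_assoc]

lemma solves_iff {α ω κ : ℝ} {u : ℝ → ℝ} {g : ℝ → ℂ} (h : IsFT (fun x => (u x : ℂ)) g) :
    Solves α ω κ u ↔ MemH (α / 2) u ∧ ∀ᵐ ξ : ℝ, ((symb α ξ + ω : ℝ) : ℂ) * g ξ =
      (κ : ℂ) * 𝓕 (fun x : ℝ => ((u x ^ 2 : ℝ) : ℂ)) ξ := by
  refine and_congr_right fun _ => eventually_congr ?_
  filter_upwards [(isFT_fourierL2 h.memLp_left).unique h] with ξ hξ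
  rw [hξ, sub_eq_zero, ofReal_add, add_mul]

lemma Solves.memLp {α ω κ : ℝ} {u : ℝ → ℝ} (h : Solves α ω κ u) :
    MemLp (fun x => (u x : ℂ)) 2 volume := h.1.1

lemma fourier_sq_const_mul_comp_mul (a : ℝ) {b : ℝ} (hb : 0 < b) (u : ℝ → ℝ) (ξ : ℝ) :
    𝓕 (fun x : ℝ => (((a * u (b * x)) ^ 2 : ℝ) : ℂ)) ξ =
      (a : ℂ) ^ 2 * ((b : ℂ)⁻¹ * 𝓕 (fun x : ℝ => ((u x ^ 2 : ℝ) : ℂ)) (b⁻¹ * ξ)) := by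
  rw [← fourier_comp_mul hb (fun x => ((u x ^ 2 : ℝ) : ℂ)), Real.fourier_real_eq,
    Real.fourier_real_eq, ← integral_const_mul]
  congr 1 with x
  rw [Circle.smul_def, Circle.smul_def, smul_eq_mul, smul_eq_mul, mul_pow, ofReal_mul, ofReal_pow,
    mul_left_comm]

lemma ae_comp_mul {b : ℝ} (hb : b ≠ 0) {p : ℝ → Prop} (h : ∀ᵐ x, p x) : ∀ᵐ x, p (b * x) :=
  (Measure.QuasiMeasurePreserving.ae
    ⟨measurable_const_mul b, by
      rw [Real.map_volume_mul_left hb]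
      exact Measure.smul_absolutelyContinuous⟩ h :)

lemma Solves.const_mul_comp_mul {α ω κ a b : ℝ} (hα : 0 ≤ α) (ha : a ≠ 0) (hb : 0 < b) {u : ℝ → ℝ}
    (h : Solves α ω κ u) :
    Solves α (ω * b ^ α) (κ * b ^ α / a) (fun x => a * u (b * x)) := by
  have hu := isFT_fourierL2 h.memLp
  have hscaled : IsFT (fun x => ((a * u (b * x) : ℝ) : ℂ))
      (fun ξ => (a : ℂ) * ((b : ℂ)⁻¹ * fourierL2 u (b⁻¹ * ξ))) := by
    simpa using (hu.comp_mul hb).const_mul (a : ℂ)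
  have hsymb : ∀ ξ, symb α ξ = b ^ α * symb α (b⁻¹ * ξ) := fun ξ => by
    rw [← symb_mul hb, mul_inv_cancel_left₀ hb.ne']
  refine (solves_iff hscaled).2 ⟨h.1.const_mul_comp_mul (by linarith) a hb, ?_⟩
  filter_upwards [ae_comp_mul (inv_ne_zero hb.ne') ((solves_iff hu).1 h).2] with ξ hξ
  have ha' : (a : ℂ)⁻¹ * a ^ 2 = a := by
    have := ofReal_ne_zero.2 ha
    field_simp
  rw [fourier_sq_const_mul_comp_mul a hb, hsymb]
  generalize 𝓕 (fun x : ℝ => ((u x ^ 2 : ℝ) : ℂ)) (b⁻¹ * ξ) = w at hξ ⊢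
  push_cast at hξ ⊢
  linear_combination ((b ^ α : ℝ) : ℂ) * a * (b : ℂ)⁻¹ * hξ
    - ((b ^ α : ℝ) : ℂ) * (b : ℂ)⁻¹ * κ * w * ha'

lemma enorm_fourier_sq_le {u : ℝ → ℝ} {g : ℝ → ℂ} (h : IsFT (fun x => (u x : ℂ)) g) (ξ : ℝ) :
    ‖𝓕 (fun x : ℝ => ((u x ^ 2 : ℝ) : ℂ)) ξ‖ₑ ≤ ∫⁻ η, ‖g η‖ₑ * ‖g (η - ξ)‖ₑ := by
  have fourier_sq : 𝓕 (fun x : ℝ => ((u x ^ 2 : ℝ) : ℂ)) ξ =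
      ∫ η, g η * (starRingEnd ℂ) (g (η - ξ)) := by
    rw [← (h.modulate ξ).integral_conj_mul h, Real.fourier_real_eq_integral_exp_smul]
    congr 1 with x
    simp only [map_mul, conj_ofReal, ← exp_conj, conj_I, smul_eq_mul, map_ofNat]
    push_cast
    ring_nf
  rw [fourier_sq]
  simpa only [enorm_mul, RCLike.enorm_conj] using
    enorm_integral_le_lintegral_enorm fun η => g η * (starRingEnd ℂ) (g (η - ξ))

end FBBM

end

/-! ### Regularity of solutions -/

noncomputable section

namespace FBBM

open Filter
open scoped ENNReal

/-- The Sobolev weight `(1 + |ξ|)^s`, as an extended nonnegative number. -/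
def weight (s ξ : ℝ) : ℝ≥0∞ := ENNReal.ofReal ((1 + |ξ|) ^ s)

/-- The autocorrelation `∫ G(η) G(η - ξ) dη` of a nonnegative function `G`. For `G = |û|` it bounds
the Fourier transform of `u²`. -/
def autocorr (G : ℝ → ℝ≥0∞) (ξ : ℝ) : ℝ≥0∞ := ∫⁻ η, G η * G (η - ξ)

@[fun_prop]
lemma measurable_weight (s : ℝ) : Measurable (weight s) := by
  unfold weight
  fun_prop

lemma weight_zero (ξ : ℝ) : weight 0 ξ = 1 := by simp [weight]

lemma weight_mul (s t ξ : ℝ) : weight s ξ * weight t ξ = weight (s + t) ξ := by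
  rw [weight, weight, ← ENNReal.ofReal_mul (by positivity), ← Real.rpow_add (by positivity), weight]

lemma weight_rpow (s p ξ : ℝ) : weight s ξ ^ p = weight (s * p) ξ := by
  rw [weight, ENNReal.ofReal_rpow_of_pos (by positivity), ← Real.rpow_mul (by positivity), weight]

lemma weight_mono {s t : ℝ} (h : s ≤ t) (ξ : ℝ) : weight s ξ ≤ weight t ξ :=
  ENNReal.ofReal_le_ofReal (Real.rpow_le_rpow_of_exponent_le (by linarith [abs_nonneg ξ]) h)

lemma weight_le_mul {s : ℝ} (hs : 0 ≤ s) (ξ η : ℝ) :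
    weight s ξ ≤ weight s η * weight s (η - ξ) := by
  have htri : |ξ| ≤ |η| + |η - ξ| := by simpa using abs_sub η (η - ξ)
  rw [weight, weight, weight, ← ENNReal.ofReal_mul (by positivity),
    ← Real.mul_rpow (by positivity) (by positivity)]
  refine ENNReal.ofReal_le_ofReal (Real.rpow_le_rpow (by positivity) ?_ hs)
  nlinarith [abs_nonneg η, abs_nonneg (η - ξ)]

lemma lintegral_weight_neg_lt_top {r : ℝ} (hr : 1 < r) : ∫⁻ ξ, weight (-r) ξ < ⊤ := by
  simpa [weight, Real.norm_eq_abs] using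
    finite_integral_one_add_norm (E := ℝ) (μ := volume) (r := r) (by simpa using hr)

section HolderYoung

-- Lebesgue exponents are written as `1 / x`, since the inequalities of Hölder and Young are linear
-- in the reciprocals.

lemma lintegral_weight_mul_rpow_lt_top {H : ℝ → ℝ≥0∞} (hH : Measurable H) {β x y : ℝ}
    (hx : 0 < x) (hxy : x < y) (hy : y < x + β) (h : ∫⁻ ξ, H ξ ^ (1 / x) < ⊤) :
    ∫⁻ ξ, (weight (-β) ξ * H ξ) ^ (1 / y) < ⊤ := by
  have hy0 : 0 < y := hx.trans hxy
  have hd : 0 < y - x := sub_pos.2 hxy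
  have hweight : ∫⁻ ξ, weight (-(β / (y - x))) ξ < ⊤ :=
    lintegral_weight_neg_lt_top (by rw [lt_div_iff₀ hd]; linarith)
  have hsplit : ∀ ξ, (weight (-β) ξ * H ξ) ^ (1 / y) =
      weight (-(β / (y - x))) ξ ^ ((y - x) / y) * (H ξ ^ (1 / x)) ^ (x / y) := fun ξ => by
    rw [ENNReal.mul_rpow_of_nonneg _ _ (by positivity), weight_rpow, weight_rpow,
      ← ENNReal.rpow_mul]
    congr 2 <;> field_simp
  calc ∫⁻ ξ, (weight (-β) ξ * H ξ) ^ (1 / y)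
      ≤ (∫⁻ ξ, weight (-(β / (y - x))) ξ) ^ ((y - x) / y) * (∫⁻ ξ, H ξ ^ (1 / x)) ^ (x / y) := by
        simp only [hsplit]
        exact ENNReal.lintegral_mul_norm_pow_le (by fun_prop) (by fun_prop) (by positivity)
          (by positivity) (by field_simp; ring)
    _ < ⊤ := ENNReal.mul_lt_top (ENNReal.rpow_lt_top_of_nonneg (by positivity) hweight.ne)
        (ENNReal.rpow_lt_top_of_nonneg (by positivity) h.ne)

lemma measurable_autocorr {G : ℝ → ℝ≥0∞} (hG : Measurable G) : Measurable (autocorr G) :=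
  Measurable.lintegral_prod_right' (f := fun p : ℝ × ℝ => G p.2 * G (p.2 - p.1)) (by fun_prop)

lemma lintegral_autocorr {G : ℝ → ℝ≥0∞} (hG : Measurable G) :
    ∫⁻ ξ, autocorr G ξ = (∫⁻ ξ, G ξ) ^ 2 := by
  have htranslate : ∀ η, ∫⁻ ξ, G η * G (η - ξ) = G η * ∫⁻ ξ, G ξ := fun η => by
    rw [lintegral_const_mul _ (by fun_prop), lintegral_sub_left_eq_self G η]
  unfold autocorr
  rw [lintegral_lintegral_swap (by fun_prop), lintegral_congr htranslate, lintegral_mul_const _ hG,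
    sq]

lemma autocorr_le {G : ℝ → ℝ≥0∞} (hG : Measurable G) {x : ℝ} (hx : 1 / 2 ≤ x) (hx1 : x ≤ 1)
    (ξ : ℝ) : autocorr G ξ ≤ autocorr (fun η => G η ^ (1 / x)) ξ ^ (2 * x - 1) *
      (∫⁻ η, G η ^ (1 / x)) ^ (2 * (1 - x)) := by
  have : 0 < x := by linarith
  have hsplit : ∀ η, G η * G (η - ξ) = (G η ^ (1 / x) * G (η - ξ) ^ (1 / x)) ^ (2 * x - 1) *
      ((G η ^ (1 / x)) ^ (1 / 2 : ℝ) * (G (η - ξ) ^ (1 / x)) ^ (1 / 2 : ℝ)) ^ (2 * (1 - x)) :=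
    fun η => by
      have hexp : ∀ a : ℝ≥0∞, (a ^ (1 / x)) ^ (2 * x - 1) *
          ((a ^ (1 / x)) ^ (1 / 2 : ℝ)) ^ (2 * (1 - x)) = a := fun a => by
        rw [← ENNReal.rpow_mul _ (1 / 2), ← ENNReal.rpow_add_of_nonneg _ _ (by linarith)
          (by linarith), ← ENNReal.rpow_mul]
        convert ENNReal.rpow_one a using 2
        field_simp
        ring
      rw [ENNReal.mul_rpow_of_nonneg _ _ (by linarith),
        ENNReal.mul_rpow_of_nonneg _ _ (by linarith), mul_mul_mul_comm, hexp, hexp]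
  have hCS : ∫⁻ η, (G η ^ (1 / x)) ^ (1 / 2 : ℝ) * (G (η - ξ) ^ (1 / x)) ^ (1 / 2 : ℝ) ≤
      ∫⁻ η, G η ^ (1 / x) := by
    refine (ENNReal.lintegral_mul_norm_pow_le (by fun_prop) (by fun_prop) (by norm_num)
      (by norm_num) (by norm_num)).trans_eq ?_
    rw [lintegral_sub_right_eq_self (fun η => G η ^ (1 / x)) ξ,
      ← ENNReal.rpow_add_of_nonneg _ _ (by norm_num) (by norm_num), add_halves, ENNReal.rpow_one]
  calc autocorr G ξ ≤ autocorr (fun η => G η ^ (1 / x)) ξ ^ (2 * x - 1) *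
        (∫⁻ η, (G η ^ (1 / x)) ^ (1 / 2 : ℝ) * (G (η - ξ) ^ (1 / x)) ^ (1 / 2 : ℝ)) ^
          (2 * (1 - x)) := by
        rw [autocorr, lintegral_congr hsplit]
        exact ENNReal.lintegral_mul_norm_pow_le (by fun_prop) (by fun_prop) (by linarith)
          (by linarith) (by ring)
    _ ≤ _ := by gcongr

lemma lintegral_autocorr_rpow_le {G : ℝ → ℝ≥0∞} (hG : Measurable G) {x : ℝ} (hx : 1 / 2 < x)
    (hx1 : x ≤ 1) :
    ∫⁻ ξ, autocorr G ξ ^ (1 / (2 * x - 1)) ≤ (∫⁻ ξ, G ξ ^ (1 / x)) ^ (2 * x / (2 * x - 1)) := by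
  have hz : 0 < 2 * x - 1 := by linarith
  set S := ∫⁻ ξ, G ξ ^ (1 / x)
  calc ∫⁻ ξ, autocorr G ξ ^ (1 / (2 * x - 1))
      ≤ ∫⁻ ξ, autocorr (fun η => G η ^ (1 / x)) ξ * S ^ (2 * (1 - x) / (2 * x - 1)) := by
        refine lintegral_mono fun ξ => ?_
        refine (ENNReal.rpow_le_rpow (autocorr_le hG hx.le hx1 ξ) (by positivity)).trans_eq ?_
        rw [ENNReal.mul_rpow_of_nonneg _ _ (by positivity), ← ENNReal.rpow_mul, ← ENNReal.rpow_mul,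
          mul_one_div_cancel hz.ne', ENNReal.rpow_one, mul_one_div]
    _ = S ^ (2 : ℝ) * S ^ (2 * (1 - x) / (2 * x - 1)) := by
        rw [lintegral_mul_const _ (measurable_autocorr (by fun_prop)),
          lintegral_autocorr (by fun_prop), ENNReal.rpow_two]
    _ = S ^ (2 * x / (2 * x - 1)) := by
        rw [← ENNReal.rpow_add_of_nonneg _ _ (by norm_num)
          (div_nonneg (by linarith) hz.le)]
        congr 1
        field_simp
        ring

end HolderYoung

section Bootstrap

variable {G : ℝ → ℝ≥0∞} {α : ℝ} {C : ℝ≥0∞}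

lemma lintegral_rpow_lt_top_step (hG : Measurable G) (hC : C ≠ ⊤)
    (h : ∀ᵐ ξ, G ξ ≤ C * (weight (-α) ξ * autocorr G ξ)) {x y : ℝ}
    (hx : 1 / 2 < x) (hx1 : x < 1) (hxy : x ≤ y) (hy : y < 2 * x - 1 + α)
    (hi : ∫⁻ ξ, G ξ ^ (1 / x) < ⊤) : ∫⁻ ξ, G ξ ^ (1 / y) < ⊤ := by
  have hz : 0 < 2 * x - 1 := by linarith
  have hy0 : 0 < y := by linarith
  have hautocorr : ∫⁻ ξ, autocorr G ξ ^ (1 / (2 * x - 1)) < ⊤ :=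
    (lintegral_autocorr_rpow_le hG hx hx1.le).trans_lt
      (ENNReal.rpow_lt_top_of_nonneg (by positivity) hi.ne)
  have hCy : C ^ (1 / y) ≠ ⊤ := ENNReal.rpow_ne_top_of_nonneg (by positivity) hC
  calc ∫⁻ ξ, G ξ ^ (1 / y) ≤ ∫⁻ ξ, C ^ (1 / y) * (weight (-α) ξ * autocorr G ξ) ^ (1 / y) := by
        refine lintegral_mono_ae ?_
        filter_upwards [h] with ξ hξ
        rw [← ENNReal.mul_rpow_of_nonneg _ _ (by positivity)]
        exact ENNReal.rpow_le_rpow hξ (by positivity)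
    _ = C ^ (1 / y) * ∫⁻ ξ, (weight (-α) ξ * autocorr G ξ) ^ (1 / y) := lintegral_const_mul' _ _ hCy
    _ < ⊤ := ENNReal.mul_lt_top hCy.lt_top (lintegral_weight_mul_rpow_lt_top
        (measurable_autocorr hG) hz (by linarith) hy hautocorr)

/-- Each application of the previous step gains `x - (1 - α)`, so `(1 - x) / N` for large `N`. -/
lemma lintegral_lt_top_of_rpow (hG : Measurable G) (hC : C ≠ ⊤)
    (h : ∀ᵐ ξ, G ξ ≤ C * (weight (-α) ξ * autocorr G ξ)) {x : ℝ} (hx : 1 / 2 < x) (hx1 : x < 1)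
    (hxα : 1 - α < x) (hi : ∫⁻ ξ, G ξ ^ (1 / x) < ⊤) : ∫⁻ ξ, G ξ < ⊤ := by
  obtain ⟨N, hN⟩ := exists_nat_gt ((1 - x) / (x - (1 - α)))
  have hgap : 0 < x - (1 - α) := sub_pos.2 hxα
  have hN0 : (0 : ℝ) < N := (div_pos (sub_pos.2 hx1) hgap).trans hN
  set d := (1 - x) / N with hd
  have hd0 : 0 < d := div_pos (sub_pos.2 hx1) hN0
  have hdgap : d < x - (1 - α) := by
    rw [div_lt_iff₀ hgap] at hN
    rw [hd, div_lt_iff₀ hN0]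
    linarith
  have hNd : N * d = 1 - x := mul_div_cancel₀ _ hN0.ne'
  have hiter : ∀ n : ℕ, n ≤ N → ∫⁻ ξ, G ξ ^ (1 / (x + n * d)) < ⊤ := by
    intro n
    induction n with
    | zero => simpa using hi
    | succ n ih =>
      intro hn
      have hnN : (n : ℝ) + 1 ≤ N := by exact_mod_cast hn
      have hnd : 0 ≤ n * d := by positivity
      refine lintegral_rpow_lt_top_step hG hC h (by linarith) ?_ ?_ ?_ (ih (Nat.le_of_succ_le hn))
      · nlinarith
      · push_cast
        linarith
      · push_cast
        linarith
  simpa [hNd] using hiter N le_rfl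

lemma lintegral_lt_top_of_le_autocorr (hα : 1 / 3 < α) (hG : Measurable G) (hC : C ≠ ⊤)
    (h : ∀ᵐ ξ, G ξ ≤ C * (weight (-α) ξ * autocorr G ξ))
    (h2 : ∫⁻ ξ, (weight (α / 2) ξ * G ξ) ^ (2 : ℝ) < ⊤) : ∫⁻ ξ, G ξ < ⊤ := by
  obtain ⟨x, hxl, hxr⟩ : ∃ x, max (1 / 2) (1 - α) < x ∧ x < min 1 (1 / 2 + α / 2) :=
    exists_between (max_lt (lt_min (by norm_num) (by linarith))
      (lt_min (by linarith) (by linarith)))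
  obtain ⟨hx, hxα⟩ := max_lt_iff.1 hxl
  obtain ⟨hx1, hxα'⟩ := lt_min_iff.1 hxr
  refine lintegral_lt_top_of_rpow hG hC h hx hx1 hxα ?_
  have hHolder := lintegral_weight_mul_rpow_lt_top (H := fun ξ => weight (α / 2) ξ * G ξ)
    (by fun_prop) (x := 1 / 2) (by norm_num) hx hxα' (by simpa using h2)
  simpa only [← mul_assoc, weight_mul, neg_add_cancel, weight_zero, one_mul] using hHolder

lemma weight_mul_autocorr_le {s : ℝ} (hs : 0 ≤ s) (hG : Measurable G) (ξ : ℝ) :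
    weight s ξ * autocorr G ξ ≤ autocorr (fun η => weight s η * G η) ξ := by
  rw [autocorr, ← lintegral_const_mul _ (by fun_prop)]
  refine lintegral_mono fun η => ?_
  rw [mul_mul_mul_comm]
  gcongr
  exact weight_le_mul hs ξ η

lemma lintegral_weight_mul_lt_top_step {s : ℝ} (hs : 0 ≤ s) (hG : Measurable G)
    (hC : C ≠ ⊤) (h : ∀ᵐ ξ, G ξ ≤ C * (weight (-α) ξ * autocorr G ξ))
    (hi : ∫⁻ ξ, weight s ξ * G ξ < ⊤) : ∫⁻ ξ, weight (s + α) ξ * G ξ < ⊤ := by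
  calc ∫⁻ ξ, weight (s + α) ξ * G ξ
      ≤ ∫⁻ ξ, C * autocorr (fun η => weight s η * G η) ξ := by
        refine lintegral_mono_ae ?_
        filter_upwards [h] with ξ hξ
        calc weight (s + α) ξ * G ξ
            ≤ weight (s + α) ξ * (C * (weight (-α) ξ * autocorr G ξ)) := by gcongr
          _ = C * (weight s ξ * autocorr G ξ) := by
              rw [mul_left_comm, ← mul_assoc (weight _ _), weight_mul, add_neg_cancel_right]
          _ ≤ C * autocorr (fun η => weight s η * G η) ξ := by
              gcongr
              exact weight_mul_autocorr_le hs hG ξ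
    _ = C * (∫⁻ ξ, weight s ξ * G ξ) ^ 2 := by
        rw [lintegral_const_mul _ (measurable_autocorr (by fun_prop)),
          lintegral_autocorr (by fun_prop)]
    _ < ⊤ := ENNReal.mul_lt_top hC.lt_top (ENNReal.pow_lt_top hi)

lemma lintegral_weight_mul_lt_top (hα : 0 < α) (hG : Measurable G)
    (hC : C ≠ ⊤) (h : ∀ᵐ ξ, G ξ ≤ C * (weight (-α) ξ * autocorr G ξ))
    (hi : ∫⁻ ξ, G ξ < ⊤) (s : ℝ) : ∫⁻ ξ, weight s ξ * G ξ < ⊤ := by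
  have hmul : ∀ n : ℕ, ∫⁻ ξ, weight (n * α) ξ * G ξ < ⊤ := by
    intro n
    induction n with
    | zero => simpa [weight_zero] using hi
    | succ n ih =>
      rw [Nat.cast_succ, add_one_mul]
      exact lintegral_weight_mul_lt_top_step (by positivity) hG hC h ih
  obtain ⟨n, hn⟩ := exists_nat_ge (s / α)
  refine (lintegral_mono fun ξ => ?_).trans_lt (hmul n)
  gcongr
  exact weight_mono ((div_le_iff₀ hα).1 hn) ξ

end Bootstrap

end FBBM

end

noncomputable section

namespace FBBM

open Complex Filter Topology
open scoped ENNReal NNReal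

lemma norm_fourier_le (f : ℝ → ℂ) (x : ℝ) : ‖𝓕 f x‖ ≤ ∫ ξ, ‖f ξ‖ :=
  VectorFourier.norm_fourierIntegral_le_integral_norm _ _ _ _ _

lemma exists_lipschitzWith_fourier {g : ℝ → ℂ} (hg : Integrable g)
    (hg' : Integrable fun ξ : ℝ => ξ • g ξ) : ∃ K : ℝ≥0, LipschitzWith K (𝓕 g) := by
  have hderiv := Real.hasDerivAt_fourier hg hg'
  refine ⟨(∫ ξ : ℝ, ‖(-2 * Real.pi * I * ξ) • g ξ‖).toNNReal,
    lipschitzWith_of_nnnorm_deriv_le (fun x => (hderiv x).differentiableAt) fun x => ?_⟩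
  rw [(hderiv x).deriv, ← NNReal.coe_le_coe, coe_nnnorm, Real.coe_toNNReal _ (by positivity)]
  exact norm_fourier_le _ x

section Regularity

variable {α ω κ : ℝ} {u : ℝ → ℝ}

lemma one_add_abs_rpow_le_symb_add (hα : 0 ≤ α) (hω : 0 < ω) (ξ : ℝ) :
    (1 + |ξ|) ^ α ≤ 2 ^ α / min 1 ω * (symb α ξ + ω) := by
  refine (one_add_abs_rpow_le hα ξ).trans ?_
  rw [div_mul_eq_mul_div, le_div_iff₀ (lt_min one_pos hω), mul_assoc]
  gcongr
  nlinarith [symb_nonneg α ξ, min_le_left 1 ω, min_le_right 1 ω]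

lemma weight_mul_enorm_le (hα : 0 ≤ α) (hω : 0 < ω) (ξ : ℝ) (z : ℂ) :
    weight α ξ * ‖z‖ₑ ≤
      ENNReal.ofReal (2 ^ α / min 1 ω) * ‖((symb α ξ + ω : ℝ) : ℂ) * z‖ₑ := by
  have hsum : 0 ≤ symb α ξ + ω := add_nonneg (symb_nonneg α ξ) hω.le
  rw [enorm_mul, ← ofReal_norm (Complex.ofReal _), Complex.norm_of_nonneg hsum, ← mul_assoc,
    ← ENNReal.ofReal_mul' hsum]
  gcongr
  exact ENNReal.ofReal_le_ofReal (one_add_abs_rpow_le_symb_add hα hω ξ)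

lemma Solves.enorm_fourierL2_le (hα : 0 ≤ α) (hω : 0 < ω) (h : Solves α ω κ u) :
    ∃ C : ℝ≥0∞, C ≠ ⊤ ∧ ∀ᵐ ξ, ‖fourierL2 u ξ‖ₑ ≤
      C * (weight (-α) ξ * autocorr (fun η => ‖fourierL2 u η‖ₑ) ξ) := by
  have hu := isFT_fourierL2 h.memLp
  refine ⟨ENNReal.ofReal (2 ^ α / min 1 ω) * ‖(κ : ℂ)‖ₑ,
    ENNReal.mul_ne_top ENNReal.ofReal_ne_top enorm_ne_top, ?_⟩
  filter_upwards [((solves_iff hu).1 h).2] with ξ hξ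
  calc ‖fourierL2 u ξ‖ₑ = weight (-α) ξ * (weight α ξ * ‖fourierL2 u ξ‖ₑ) := by
        rw [← mul_assoc, weight_mul, neg_add_cancel, weight_zero, one_mul]
    _ ≤ weight (-α) ξ * (ENNReal.ofReal (2 ^ α / min 1 ω) * (‖(κ : ℂ)‖ₑ *
          autocorr (fun η => ‖fourierL2 u η‖ₑ) ξ)) := by
        gcongr weight (-α) ξ * ?_
        refine (weight_mul_enorm_le hα hω ξ _).trans ?_
        rw [hξ, enorm_mul]
        gcongr _ * (_ * ?_)
        exact enorm_fourier_sq_le hu ξ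
    _ = _ := by ring

lemma Solves.integrable_fourierL2 (hα : 1 / 3 < α) (hω : 0 < ω) (h : Solves α ω κ u) :
    Integrable (fourierL2 u) ∧ Integrable (fun ξ : ℝ => ξ • fourierL2 u ξ) := by
  have hα0 : 0 < α := by linarith
  obtain ⟨C, hC, hle⟩ := h.enorm_fourierL2_le hα0.le hω
  have hu := isFT_fourierL2 h.memLp
  have hmeas := measurable_fourierL2 u
  have hL2 : ∫⁻ ξ, (weight (α / 2) ξ * ‖fourierL2 u ξ‖ₑ) ^ (2 : ℝ) < ⊤ := by
    have hH := memLp_one_add_abs_rpow_mul (by linarith) hu.memLp_right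
      ((memH_iff (by linarith) hu).1 h.1)
    have hint := lintegral_rpow_enorm_lt_top_of_eLpNorm_lt_top (by norm_num) (by norm_num) hH.2
    refine lt_of_eq_of_lt (lintegral_congr fun ξ => ?_) hint
    rw [enorm_mul, ← ofReal_norm (Complex.ofReal _), Complex.norm_of_nonneg (by positivity),
      weight, ENNReal.toReal_ofNat]
  have hL1 := lintegral_lt_top_of_le_autocorr hα hmeas.enorm hC hle hL2
  refine ⟨⟨hmeas.aestronglyMeasurable, hL1⟩, (measurable_id.smul hmeas).aestronglyMeasurable,
    (lintegral_mono fun ξ => ?_).trans_lt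
      (lintegral_weight_mul_lt_top hα0 hmeas.enorm hC hle hL1 1)⟩
  rw [enorm_smul, weight, Real.rpow_one, ← ofReal_norm, Real.norm_eq_abs]
  gcongr
  linarith

lemma Solves.exists_representative (hα : 1 / 3 < α) (hω : 0 < ω) (h : Solves α ω κ u) :
    ∃ (U : ℝ → ℝ) (K : ℝ≥0) (B : ℝ), u =ᵐ[volume] U ∧ LipschitzWith K U ∧ (∀ x, |U x| ≤ B) ∧
      Tendsto U (cocompact ℝ) (𝓝 0) := by
  obtain ⟨hint, hint'⟩ := h.integrable_fourierL2 hα hω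
  obtain ⟨K, hK⟩ := exists_lipschitzWith_fourier hint hint'
  set g := fourierL2 u
  refine ⟨fun x => (𝓕 g (-x)).re, K, ∫ ξ, ‖g ξ‖, ?_, ?_, fun x => ?_, ?_⟩
  · filter_upwards [(isFT_fourierL2 h.memLp).ae_eq_fourierInv hint] with x hx
    rw [← Real.fourierInv_eq_fourier_neg, ← hx, ofReal_re]
  · refine .of_dist_le_mul fun x y => ?_
    calc dist (𝓕 g (-x)).re (𝓕 g (-y)).re ≤ dist (𝓕 g (-x)) (𝓕 g (-y)) := by
          rw [dist_eq_norm, dist_eq_norm, ← sub_re]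
          exact abs_re_le_norm _
      _ ≤ K * dist x y := by simpa only [dist_neg_neg] using hK.dist_le_mul (-x) (-y)
  · exact (abs_re_le_norm _).trans (norm_fourier_le g (-x))
  · exact (continuous_re.tendsto' 0 0 zero_re).comp
      ((Real.zero_at_infty_fourier g).comp (Homeomorph.neg ℝ).isClosedEmbedding.tendsto_cocompact)

end Regularity

end FBBM

end

/-! ### Pohozaev's identity -/

noncomputable section

namespace FBBM

open Filter Topology
open scoped NNReal

lemma MemH.half {s : ℝ} (hs : 0 ≤ s) {u : ℝ → ℝ} (h : MemH s u) : MemH (s / 2) u := by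
  have hu := isFT_fourierL2 h.1
  have hsum : MemLp (fun ξ => ((1 + symb s ξ : ℝ) : ℂ) * fourierL2 u ξ) 2 volume := by
    refine (hu.memLp_right.add ((memH_iff hs hu).1 h)).ae_eq (.of_forall fun ξ => ?_)
    simp only [Pi.add_apply]
    push_cast
    ring
  refine (memH_iff (by linarith) hu).2 (memLp_ofReal_mul_of_le (C := 1) (measurable_symb _)
    hu.memLp_right.1 hsum fun ξ => ?_)
  have hsq := symb_half_sq hs ξ
  rw [one_mul, abs_of_nonneg (symb_nonneg _ ξ), abs_of_nonneg (by linarith [symb_nonneg s ξ])]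
  nlinarith [sq_nonneg (symb (s / 2) ξ - 1), symb_nonneg (s / 2) ξ]

section RealValued

variable {s : ℝ} {u v u' v' : ℝ → ℝ}

lemma integral_ofReal_mul_conj (u v : ℝ → ℝ) :
    ∫ x, (u x : ℂ) * (starRingEnd ℂ) (v x : ℂ) = ((∫ x, u x * v x : ℝ) : ℂ) := by
  simp only [Complex.conj_ofReal, ← Complex.ofReal_mul, integral_complex_ofReal]

lemma HasFracD.memLp_ofReal (h : HasFracD s (fun x => (u x : ℂ)) (fun x => (v x : ℂ))) :
    MemLp u 2 volume ∧ MemLp v 2 volume := by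
  obtain ⟨g, hu, hv⟩ := h
  exact ⟨by simpa using hu.memLp_left.re, by simpa using hv.memLp_left.re⟩

lemma HasFracD.comp_mul_ofReal (h : HasFracD s (fun x => (u x : ℂ)) (fun x => (v x : ℂ)))
    {l : ℝ} (hl : 0 < l) :
    HasFracD s (fun x => (u (l * x) : ℂ)) (fun x => ((l ^ s * v (l * x) : ℝ) : ℂ)) := by
  simpa only [Complex.ofReal_mul] using h.comp_mul hl

lemma HasFracD.integral_mul_comm (h : HasFracD s (fun x => (u x : ℂ)) (fun x => (v x : ℂ)))
    (h' : HasFracD s (fun x => (u' x : ℂ)) (fun x => (v' x : ℂ))) :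
    ∫ x, v' x * u x = ∫ x, u' x * v x := by
  have := h.integral_mul_conj_comm h'
  rwa [integral_ofReal_mul_conj, integral_ofReal_mul_conj, Complex.ofReal_inj] at this

lemma HasFracD.integral_mul_self (hs : 0 ≤ s)
    (h : HasFracD s (fun x => (u x : ℂ)) (fun x => (v x : ℂ))) :
    ∫ x, v x * u x = ∫ x, ‖fracD (s / 2) u x‖ ^ 2 := by
  have := h.integral_mul_conj_half hs (hasFracD_fracD (by linarith) ((h.memH hs).half hs))
  rwa [integral_ofReal_mul_conj, Complex.ofReal_inj] at this

lemma HasFracD.integral_mul_dilation (h : HasFracD s (fun x => (u x : ℂ)) (fun x => (v x : ℂ)))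
    {l : ℝ} (hl : 0 < l) :
    ∫ x, v x * u (l * x) = l ^ s * ∫ x, u x * v (l * x) := by
  simp only [(h.comp_mul_ofReal hl).integral_mul_comm h, mul_left_comm (u _), integral_const_mul]

lemma HasFracD.integral_dilation_sub_nonneg (hs : 0 ≤ s)
    (h : HasFracD s (fun x => (u x : ℂ)) (fun x => (v x : ℂ))) {l : ℝ} (hl : 0 < l) :
    0 ≤ ∫ x, (l ^ s * v (l * x) - v x) * (u (l * x) - u x) := by
  have hsub := (h.comp_mul_ofReal hl).sub h
  simp only [← Complex.ofReal_sub] at hsub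
  rw [hsub.integral_mul_self hs]
  positivity

end RealValued

/-- The right-hand side of the equation `D^α u = κ u² - ω u`. -/
def reaction (ω κ t : ℝ) : ℝ := κ * t ^ 2 - ω * t

lemma reaction_sub (ω κ s t : ℝ) :
    reaction ω κ s - reaction ω κ t = (κ * (s + t) - ω) * (s - t) := by
  unfold reaction
  ring

/-- Coercivity of the linearization where `κ (s + t)` is small. -/
lemma sq_sub_le_of_reaction {ω : ℝ} (hω : 0 < ω) (κ δ s t : ℝ) :
    ω / 4 * (s - t) ^ 2 ≤ (|κ * (s + t)| - ω / 2) * (s - t) ^ 2 + δ ^ 2 / ω * reaction ω κ s ^ 2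
      - ((1 + δ) * reaction ω κ s - reaction ω κ t) * (s - t) := by
  have hsq : 0 ≤ (ω / 2 * (s - t) - δ * reaction ω κ s) ^ 2 / ω := by positivity
  have hexpand : (ω / 2 * (s - t) - δ * reaction ω κ s) ^ 2 / ω =
      ω / 4 * (s - t) ^ 2 - δ * reaction ω κ s * (s - t) + δ ^ 2 / ω * reaction ω κ s ^ 2 := by
    field_simp
    ring
  have habs := mul_le_mul_of_nonneg_right (le_abs_self (κ * (s + t))) (sq_nonneg (s - t))
  linear_combination hsq + habs + hexpand + (s - t) * reaction_sub ω κ s t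

section Dilation

variable {ω κ B : ℝ} {K : ℝ≥0} {U : ℝ → ℝ}

lemma integral_comp_mul_pos {l : ℝ} (hl : 0 < l) (F : ℝ → ℝ) :
    ∫ x, F (l * x) = l⁻¹ * ∫ x, F x := by
  rw [Measure.integral_comp_mul_left F l, abs_of_pos (inv_pos.2 hl), smul_eq_mul]

lemma exists_abs_le_of_tendsto_cocompact (h0 : Tendsto U (cocompact ℝ) (𝓝 0)) {ε : ℝ}
    (hε : 0 < ε) : ∃ R, 0 ≤ R ∧ ∀ x, R < |x| → |U x| ≤ ε := by
  have hsmall : ∀ᶠ x in cocompact ℝ, |U x| ≤ ε :=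
    (tendsto_zero_iff_abs_tendsto_zero U).1 h0 |>.eventually_le_const hε
  rw [← Metric.cobounded_eq_cocompact, ← comap_norm_atTop, eventually_comap,
    eventually_atTop] at hsmall
  obtain ⟨R, hR⟩ := hsmall
  exact ⟨max R 0, le_max_right R 0, fun x hx => hR |x| ((le_max_left R 0).trans hx.le) x rfl⟩

lemma abs_dilation_sub_le (hK : LipschitzWith K U) {l : ℝ} (hl : 1 < l) (x : ℝ) :
    |U (l * x) - U x| ≤ K * |x| * (l - 1) := by
  have := hK.dist_le_mul (l * x) x
  rwa [Real.dist_eq, Real.dist_eq, ← sub_one_mul, abs_mul, abs_of_pos (sub_pos.2 hl),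
    mul_comm (l - 1), ← mul_assoc] at this

lemma dilation_sub_sq_le_indicator (hB : ∀ x, |U x| ≤ B) (hK : LipschitzWith K U) {R : ℝ}
    (hR : ∀ x, R < |x| → |κ| * |U x| ≤ ω / 4) (hω : 0 < ω) {l : ℝ} (hl : 1 < l) (x : ℝ) :
    (|κ * (U (l * x) + U x)| - ω / 2) * (U (l * x) - U x) ^ 2 ≤
      (Icc (-R) R).indicator (fun _ => 2 * |κ| * B * (K * R) ^ 2 * (l - 1) ^ 2) x := by
  have habs : |κ * (U (l * x) + U x)| ≤ |κ| * |U (l * x)| + |κ| * |U x| := by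
    rw [abs_mul, ← mul_add]
    gcongr
    exact abs_add_le _ _
  by_cases hx : x ∈ Icc (-R) R
  · have hxR : |x| ≤ R := abs_le.2 hx
    have hcoeff : |κ * (U (l * x) + U x)| - ω / 2 ≤ 2 * |κ| * B := by
      nlinarith [hB x, hB (l * x), abs_nonneg κ]
    have hB0 : 0 ≤ B := (abs_nonneg _).trans (hB 0)
    have : 0 ≤ l - 1 := by linarith
    have hdiff : (U (l * x) - U x) ^ 2 ≤ (K * R * (l - 1)) ^ 2 := by
      rw [← sq_abs]
      gcongr
      exact (abs_dilation_sub_le hK hl x).trans (by gcongr)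
    rw [indicator_of_mem hx]
    calc (|κ * (U (l * x) + U x)| - ω / 2) * (U (l * x) - U x) ^ 2
        ≤ 2 * |κ| * B * (K * R * (l - 1)) ^ 2 := by gcongr
      _ = 2 * |κ| * B * (K * R) ^ 2 * (l - 1) ^ 2 := by ring
  · have hxR : R < |x| := lt_of_not_ge fun h => hx (abs_le.1 h)
    have hlx : R < |l * x| := by
      rw [abs_mul, abs_of_pos (one_pos.trans hl)]
      exact hxR.trans_le (le_mul_of_one_le_left (abs_nonneg x) hl.le)
    rw [indicator_of_notMem hx]
    exact mul_nonpos_of_nonpos_of_nonneg (by linarith [hR _ hxR, hR _ hlx]) (sq_nonneg _)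

lemma integral_reaction_dilation_sub_sq_le {R α l : ℝ} (hα : 0 ≤ α) (hω : 0 < ω) (hR0 : 0 ≤ R)
    (hR : ∀ x, R < |x| → |κ| * |U x| ≤ ω / 4) (hB : ∀ x, |U x| ≤ B) (hK : LipschitzWith K U)
    (hD : HasFracD α (fun x => (U x : ℂ)) (fun x => (reaction ω κ (U x) : ℂ))) (hl : 1 < l) :
    ω / 4 * ∫ x, (U (l * x) - U x) ^ 2 ≤ 2 * R * (2 * |κ| * B * (K * R) ^ 2) * (l - 1) ^ 2 +
      1 / ω * (∫ x, reaction ω κ (U x) ^ 2) * (l ^ α - 1) ^ 2 := by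
  have hl0 : 0 < l := one_pos.trans hl
  obtain ⟨hU, hV⟩ := hD.memLp_ofReal
  have hUl := memLp_comp_mul hl0.ne' hU
  have hVl := memLp_comp_mul hl0.ne' hV
  have hpair : Integrable fun x => ((1 + (l ^ α - 1)) * reaction ω κ (U (l * x)) -
      reaction ω κ (U x)) * (U (l * x) - U x) :=
    ((hVl.const_mul _).sub hV).integrable_mul (hUl.sub hU)
  have hVl2 : Integrable fun x => (l ^ α - 1) ^ 2 / ω * reaction ω κ (U (l * x)) ^ 2 :=
    hVl.integrable_sq.const_mul _
  have hind : Integrable ((Icc (-R) R).indicator fun _ =>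
      2 * |κ| * B * (K * R) ^ 2 * (l - 1) ^ 2) :=
    (integrable_indicator_iff measurableSet_Icc).2 (integrableOn_const (by simp))
  have hsum : Integrable fun x => (Icc (-R) R).indicator (fun _ =>
      2 * |κ| * B * (K * R) ^ 2 * (l - 1) ^ 2) x +
        (l ^ α - 1) ^ 2 / ω * reaction ω κ (U (l * x)) ^ 2 := hind.add hVl2
  calc ω / 4 * ∫ x, (U (l * x) - U x) ^ 2
      ≤ ∫ x, (((Icc (-R) R).indicator (fun _ => 2 * |κ| * B * (K * R) ^ 2 * (l - 1) ^ 2) x +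
          (l ^ α - 1) ^ 2 / ω * reaction ω κ (U (l * x)) ^ 2) - ((1 + (l ^ α - 1)) *
            reaction ω κ (U (l * x)) - reaction ω κ (U x)) * (U (l * x) - U x)) := by
        rw [← integral_const_mul]
        refine integral_mono ((hUl.sub hU).integrable_sq.const_mul _)
          (hsum.sub hpair) fun x => ?_
        refine (sq_sub_le_of_reaction hω κ (l ^ α - 1) _ _).trans ?_
        gcongr
        exact dilation_sub_sq_le_indicator hB hK hR hω hl x
    _ = 2 * R * (2 * |κ| * B * (K * R) ^ 2 * (l - 1) ^ 2) +
          (l ^ α - 1) ^ 2 / ω * (l⁻¹ * ∫ x, reaction ω κ (U x) ^ 2) -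
          ∫ x, (l ^ α * reaction ω κ (U (l * x)) - reaction ω κ (U x)) * (U (l * x) - U x) := by
        rw [integral_sub hsum hpair, integral_add hind hVl2, integral_const_mul,
          integral_comp_mul_pos hl0 (fun x => reaction ω κ (U x) ^ 2),
          integral_indicator measurableSet_Icc, setIntegral_const, smul_eq_mul,
          Real.volume_real_Icc_of_le (by linarith), add_sub_cancel]
        ring
    _ ≤ 2 * R * (2 * |κ| * B * (K * R) ^ 2 * (l - 1) ^ 2) +
          (l ^ α - 1) ^ 2 / ω * (1 * ∫ x, reaction ω κ (U x) ^ 2) - 0 := by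
        gcongr
        · exact inv_le_one_of_one_le₀ hl.le
        · exact hD.integral_dilation_sub_nonneg hα hl0
    _ = _ := by ring

end Dilation

lemma tendsto_rpow_sub_one_div (s : ℝ) :
    Tendsto (fun l : ℝ => (l ^ s - 1) / (l - 1)) (𝓝[>] 1) (𝓝 s) := by
  have hderiv : HasDerivAt (fun l : ℝ => l ^ s) s 1 := by
    simpa using Real.hasDerivAt_rpow_const (p := s) (Or.inl one_ne_zero)
  simpa [slope_fun_def_field] using
    hderiv.tendsto_slope.mono_left
      (nhdsWithin_mono 1 (fun _ hl => (mem_Ioi.1 hl).ne' : Ioi (1 : ℝ) ⊆ {1}ᶜ))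

lemma tendsto_sub_one : Tendsto (fun l : ℝ => l - 1) (𝓝[>] 1) (𝓝 0) :=
  ((continuous_sub_right 1).tendsto' (1 : ℝ) 0 (sub_self 1)).mono_left nhdsWithin_le_nhds

lemma tendsto_rpow_sub_one (s : ℝ) : Tendsto (fun l : ℝ => l ^ s - 1) (𝓝[>] 1) (𝓝 0) := by
  have hmul := (tendsto_rpow_sub_one_div s).mul tendsto_sub_one
  rw [mul_zero] at hmul
  refine hmul.congr' ?_
  filter_upwards [self_mem_nhdsWithin] with l (hl : 1 < l)
  exact div_mul_cancel₀ _ (sub_pos.2 hl).ne'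

section Pohozaev

variable {α ω κ B : ℝ} {K : ℝ≥0} {U : ℝ → ℝ}

lemma tendsto_integral_dilation_sub_sq_div (hα : 0 ≤ α) (hω : 0 < ω) (hB : ∀ x, |U x| ≤ B)
    (hK : LipschitzWith K U) (h0 : Tendsto U (cocompact ℝ) (𝓝 0))
    (hD : HasFracD α (fun x => (U x : ℂ)) (fun x => (reaction ω κ (U x) : ℂ))) :
    Tendsto (fun l => (∫ x, (U (l * x) - U x) ^ 2) / (l - 1)) (𝓝[>] 1) (𝓝 0) := by
  obtain ⟨R, hR0, hR⟩ := exists_abs_le_of_tendsto_cocompact (by simpa using h0.const_mul κ)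
    (by positivity : 0 < ω / 4)
  simp only [abs_mul] at hR
  set P := 2 * R * (2 * |κ| * B * (K * R) ^ 2)
  set Q := 1 / ω * ∫ x, reaction ω κ (U x) ^ 2
  have hlim : Tendsto (fun l : ℝ => 4 / ω * (P * (l - 1) + Q * ((l ^ α - 1) / (l - 1)) *
      (l ^ α - 1))) (𝓝[>] 1) (𝓝 0) := by
    simpa using ((tendsto_sub_one.const_mul P).add (((tendsto_rpow_sub_one_div α).const_mul Q).mul
      (tendsto_rpow_sub_one α))).const_mul (4 / ω)
  refine tendsto_of_tendsto_of_tendsto_of_le_of_le' tendsto_const_nhds hlim ?_ ?_ <;>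
    filter_upwards [self_mem_nhdsWithin] with l (hl : 1 < l)
  · exact div_nonneg (by positivity) (sub_pos.2 hl).le
  · have hl1 : 0 < l - 1 := sub_pos.2 hl
    have hbound := integral_reaction_dilation_sub_sq_le hα hω hR0 hR hB hK hD hl
    calc (∫ x, (U (l * x) - U x) ^ 2) / (l - 1)
        = 4 / ω * ((ω / 4 * ∫ x, (U (l * x) - U x) ^ 2) / (l - 1)) := by field_simp
      _ ≤ 4 / ω * ((P * (l - 1) ^ 2 + Q * (l ^ α - 1) ^ 2) / (l - 1)) := by gcongr
      _ = _ := by field_simp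

lemma integrable_pow_three_of_memLp (hB : ∀ x, |U x| ≤ B) (hU : MemLp U 2 volume) :
    Integrable fun x => U x ^ 3 := by
  have := hU.integrable_sq.bdd_mul (f := U) (c := B) hU.1 (.of_forall hB)
  simpa only [pow_succ' _ 2] using this

lemma abs_integral_dilation_sub_pow_three_le (hB : ∀ x, |U x| ≤ B) (hU : MemLp U 2 volume) {l : ℝ}
    (hl : l ≠ 0) :
    |∫ x, (U (l * x) - U x) ^ 3| ≤ 2 * B * ∫ x, (U (l * x) - U x) ^ 2 := by
  have hW : Integrable fun x => 2 * B * (U (l * x) - U x) ^ 2 :=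
    ((memLp_comp_mul hl hU).sub hU).integrable_sq.const_mul _
  rw [← integral_const_mul, ← Real.norm_eq_abs]
  refine norm_integral_le_of_norm_le hW (.of_forall fun x => ?_)
  rw [Real.norm_eq_abs, abs_pow, pow_succ', sq_abs]
  gcongr
  exact (abs_sub _ _).trans (by linarith [hB x, hB (l * x)])

lemma abs_mul_reaction_sub_le (hω : 0 < ω) {s t d : ℝ} (hs : |s| ≤ B) (ht : |t| ≤ B) (hd : 0 < d) :
    |t * reaction ω κ s - t * reaction ω κ t| ≤
      (2 * |κ| * B + ω) * (d * t ^ 2 + (s - t) ^ 2 / d) := by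
  have hlip : |κ * (s + t) - ω| ≤ 2 * |κ| * B + ω := by
    calc |κ * (s + t) - ω| ≤ |κ| * (|s| + |t|) + ω := by
          refine (abs_sub _ _).trans ?_
          rw [abs_mul, abs_of_pos hω]
          gcongr
          exact abs_add_le s t
      _ ≤ 2 * |κ| * B + ω := by nlinarith [abs_nonneg κ]
  have hyoung : |t * (s - t)| ≤ d * t ^ 2 + (s - t) ^ 2 / d := by
    rw [abs_mul, ← sq_abs t, ← sq_abs (s - t), ← sub_nonneg]
    generalize |s - t| = p
    generalize |t| = q
    have : d * q ^ 2 + p ^ 2 / d - q * p = ((p - d * q / 2) ^ 2 + 3 / 4 * (d * q) ^ 2) / d := by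
      field_simp
      ring
    rw [this]
    positivity
  rw [← mul_sub, reaction_sub, mul_left_comm, abs_mul]
  exact mul_le_mul hlip hyoung (abs_nonneg _) ((abs_nonneg _).trans hlip)

lemma tendsto_integral_mul_reaction_dilation (hω : 0 < ω) (hB : ∀ x, |U x| ≤ B)
    (hU : MemLp U 2 volume) (hV : MemLp (fun x => reaction ω κ (U x)) 2 volume)
    (hlim : Tendsto (fun l => (∫ x, (U (l * x) - U x) ^ 2) / (l - 1)) (𝓝[>] 1) (𝓝 0)) :
    Tendsto (fun l => ∫ x, U x * reaction ω κ (U (l * x))) (𝓝[>] 1)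
      (𝓝 (∫ x, U x * reaction ω κ (U x))) := by
  rw [tendsto_iff_norm_sub_tendsto_zero]
  have hbound : Tendsto (fun l : ℝ => (2 * |κ| * B + ω) * ((l - 1) * (∫ x, U x ^ 2) +
      (∫ x, (U (l * x) - U x) ^ 2) / (l - 1))) (𝓝[>] 1) (𝓝 0) := by
    simpa using ((tendsto_sub_one.mul_const (∫ x, U x ^ 2)).add hlim).const_mul
      (2 * |κ| * B + ω)
  refine squeeze_zero' (.of_forall fun _ => norm_nonneg _) ?_ hbound
  filter_upwards [self_mem_nhdsWithin] with l (hl : 1 < l)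
  have hl0 : l ≠ 0 := (one_pos.trans hl).ne'
  have hUV : Integrable fun x => U x * reaction ω κ (U x) := hU.integrable_mul hV
  have hUVl : Integrable fun x => U x * reaction ω κ (U (l * x)) :=
    hU.integrable_mul (memLp_comp_mul hl0 hV)
  have hU2 : Integrable fun x => (l - 1) * U x ^ 2 := hU.integrable_sq.const_mul _
  have hW : Integrable fun x => (U (l * x) - U x) ^ 2 / (l - 1) :=
    ((memLp_comp_mul hl0 hU).sub hU).integrable_sq.div_const _
  rw [← integral_sub hUVl hUV, ← integral_const_mul, ← integral_div, ← integral_add hU2 hW,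
    ← integral_const_mul]
  exact norm_integral_le_of_norm_le ((hU2.add hW).const_mul _) (.of_forall fun x =>
    abs_mul_reaction_sub_le hω (hB _) (hB x) (sub_pos.2 hl))

/-- Expand the cube: up to `reaction`, its mixed terms are `V U_l - U V_l`. -/
lemma integral_dilation_sub_pow_three (hB : ∀ x, |U x| ≤ B)
    (hD : HasFracD α (fun x => (U x : ℂ)) (fun x => (reaction ω κ (U x) : ℂ))) {l : ℝ}
    (hl : 0 < l) :
    κ * ∫ x, (U (l * x) - U x) ^ 3 = κ * ((l⁻¹ - 1) * ∫ x, U x ^ 3) +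
      3 * ((l ^ α - 1) * ∫ x, U x * reaction ω κ (U (l * x))) := by
  obtain ⟨hU, hV⟩ := hD.memLp_ofReal
  have hU3 := integrable_pow_three_of_memLp hB hU
  have hUl3 : Integrable fun x => U (l * x) ^ 3 := hU3.comp_mul_left' hl.ne'
  have hVUl : Integrable fun x => reaction ω κ (U x) * U (l * x) :=
    hV.integrable_mul (memLp_comp_mul hl.ne' hU)
  have hUVl : Integrable fun x => U x * reaction ω κ (U (l * x)) :=
    hU.integrable_mul (memLp_comp_mul hl.ne' hV)
  calc κ * ∫ x, (U (l * x) - U x) ^ 3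
      = ∫ x, (κ * (U (l * x) ^ 3 - U x ^ 3) +
          3 * (reaction ω κ (U x) * U (l * x) - U x * reaction ω κ (U (l * x)))) := by
        rw [← integral_const_mul]
        congr 1 with x
        unfold reaction
        ring
    _ = _ := by
        have hcubes : Integrable fun x => κ * (U (l * x) ^ 3 - U x ^ 3) :=
          (hUl3.sub hU3).const_mul κ
        have hmixed : Integrable fun x =>
            3 * (reaction ω κ (U x) * U (l * x) - U x * reaction ω κ (U (l * x))) :=
          (hVUl.sub hUVl).const_mul 3
        rw [integral_add hcubes hmixed, integral_const_mul, integral_const_mul,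
          integral_sub hUl3 hU3, integral_sub hVUl hUVl,
          integral_comp_mul_pos hl (fun x => U x ^ 3), hD.integral_mul_dilation hl]
        ring

lemma pohozaev (hα : 0 ≤ α) (hω : 0 < ω) (hB : ∀ x, |U x| ≤ B)
    (hK : LipschitzWith K U) (h0 : Tendsto U (cocompact ℝ) (𝓝 0))
    (hD : HasFracD α (fun x => (U x : ℂ)) (fun x => (reaction ω κ (U x) : ℂ))) :
    3 * α * ∫ x, U x * reaction ω κ (U x) = κ * ∫ x, U x ^ 3 := by
  obtain ⟨hU, hV⟩ := hD.memLp_ofReal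
  have hsq := tendsto_integral_dilation_sub_sq_div hα hω hB hK h0 hD
  have hcube : Tendsto (fun l => κ * ((∫ x, (U (l * x) - U x) ^ 3) / (l - 1))) (𝓝[>] 1)
      (𝓝 (κ * 0)) := by
    refine (squeeze_zero_norm' ?_ (by simpa using hsq.const_mul (2 * B))).const_mul κ
    filter_upwards [self_mem_nhdsWithin] with l (hl : 1 < l)
    rw [Real.norm_eq_abs, abs_div, abs_of_pos (sub_pos.2 hl), ← mul_div_assoc]
    exact div_le_div_of_nonneg_right
      (abs_integral_dilation_sub_pow_three_le hB hU (one_pos.trans hl).ne') (sub_pos.2 hl).le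
  have hslopes := (((tendsto_rpow_sub_one_div (-1)).mul_const (∫ x, U x ^ 3)).const_mul κ).add
    (((tendsto_rpow_sub_one_div α).mul
      (tendsto_integral_mul_reaction_dilation hω hB hU hV hsq)).const_mul 3)
  have heq := tendsto_nhds_unique hcube (hslopes.congr' ?_)
  · linarith
  · filter_upwards [self_mem_nhdsWithin] with l (hl : 1 < l)
    rw [← mul_div_assoc, integral_dilation_sub_pow_three hB hD (one_pos.trans hl),
      Real.rpow_neg_one]
    ring

end Pohozaev

end FBBM

end

/-! ### Momentum and ground states -/

noncomputable section

namespace FBBM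

open Filter

section Identities

variable {α ω κ : ℝ} {u : ℝ → ℝ}

lemma Solves.memLp_real (h : Solves α ω κ u) : MemLp u 2 volume := by
  simpa using h.memLp.re

lemma Solves.hasFracD_reaction (h : Solves α ω κ u)
    (hsq : MemLp (fun x => ((u x ^ 2 : ℝ) : ℂ)) 2 volume) :
    HasFracD α (fun x => (u x : ℂ)) (fun x => (reaction ω κ (u x) : ℂ)) := by
  have hu := isFT_fourierL2 h.memLp
  have hint : Integrable fun x => ((u x ^ 2 : ℝ) : ℂ) := h.memLp_real.integrable_sq.ofReal
  refine ⟨_, hu, (((IsFT.of_integrable hsq hint).const_mul (κ : ℂ)).sub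
    (hu.const_mul (ω : ℂ))).congr (.of_forall fun x => ?_) ?_⟩
  · push_cast [reaction]
    rfl
  · filter_upwards [((solves_iff hu).1 h).2] with ξ hξ
    rw [← hξ, Complex.ofReal_add]
    ring

lemma memLp_sq_of_bounded {B : ℝ} (hB : ∀ᵐ x, |u x| ≤ B) (hu : MemLp u 2 volume) :
    MemLp (fun x => u x ^ 2) 2 volume :=
  hu.of_le_mul (c := B) (hu.1.pow 2) (by
    filter_upwards [hB] with x hx
    rw [norm_pow, sq]
    exact mul_le_mul_of_nonneg_right hx (norm_nonneg _))

lemma integral_mul_reaction {B : ℝ} (hB : ∀ x, |u x| ≤ B) (hu : MemLp u 2 volume) :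
    ∫ x, u x * reaction ω κ (u x) = κ * (∫ x, u x ^ 3) - ω * ∫ x, u x ^ 2 := by
  have hcube := integrable_pow_three_of_memLp hB hu
  rw [← integral_const_mul, ← integral_const_mul,
    ← integral_sub (hcube.const_mul _) (hu.integrable_sq.const_mul _)]
  congr 1 with x
  unfold reaction
  ring

lemma Solves.memH_and_integral_identities (hα : 1 / 3 < α) (hω : 0 < ω) (h : Solves α ω κ u) :
    MemH α u ∧ (3 * α - 1) * (∫ x, ‖fracD (α / 2) u x‖ ^ 2) = ω * ∫ x, u x ^ 2 ∧
      3 * α * (∫ x, ‖fracD (α / 2) u x‖ ^ 2) = κ * ∫ x, u x ^ 3 := by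
  have hα0 : 0 ≤ α := by linarith
  obtain ⟨U, K, B, huU, hK, hB, h0⟩ := h.exists_representative hα hω
  have hbdd : ∀ᵐ x, |u x| ≤ B := huU.mono fun x hx => hx ▸ hB x
  have hD := h.hasFracD_reaction (memLp_sq_of_bounded hbdd h.memLp_real).ofReal
  have hDU : HasFracD α (fun x => (U x : ℂ)) (fun x => (reaction ω κ (U x) : ℂ)) :=
    hD.imp fun g ⟨hu, hv⟩ => ⟨hu.congr (huU.mono fun x hx => by simp only [hx]) .rfl,
      hv.congr (huU.mono fun x hx => by simp only [hx]) .rfl⟩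
  have hpow : ∀ n : ℕ, ∫ x, u x ^ n = ∫ x, U x ^ n := fun n =>
    integral_congr_ae (huU.mono fun x hx => by simp only [hx])
  have hkinetic : ∫ x, ‖fracD (α / 2) u x‖ ^ 2 = ∫ x, U x * reaction ω κ (U x) := by
    rw [← hD.integral_mul_self hα0]
    exact integral_congr_ae (huU.mono fun x hx => by simp only [hx, mul_comm])
  have henergy := integral_mul_reaction (ω := ω) (κ := κ) hB hDU.memLp_ofReal.1
  have hpohozaev := pohozaev hα0 hω hB hK h0 hDU
  rw [hkinetic, hpow, hpow]
  exact ⟨hD.memH hα0, by linarith, hpohozaev⟩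

lemma two_mul_momentum (hα : 0 ≤ α) (h : MemH α u) :
    2 * momentum α u = (∫ x, ‖fracD (α / 2) u x‖ ^ 2) + ∫ x, u x ^ 2 := by
  have hD := hasFracD_fracD hα h
  have hhalf := hD.integral_mul_conj_half hα (hasFracD_fracD (by linarith) (h.half hα))
  have hmass := integral_ofReal_mul_conj u u
  have hint : Integrable fun x => fracD α u x * (u x : ℂ) := by
    obtain ⟨g, hu, hDu⟩ := hD
    exact hDu.memLp_left.integrable_mul hu.memLp_left
  have hint' : Integrable fun x => (u x : ℂ) * (u x : ℂ) := h.1.integrable_mul h.1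
  simp only [Complex.conj_ofReal] at hhalf hmass
  simp only [momentum, add_mul]
  rw [integral_add hint hint', hhalf, hmass, ← Complex.ofReal_add, Complex.ofReal_re]
  simp only [← sq]
  ring

end Identities

section Weinstein

variable {α : ℝ}

lemma weinstein_const_mul_comp_mul (hα : 0 < α) {a b : ℝ} (ha : 0 < a) (hb : 0 < b) {v : ℝ → ℝ}
    (hv : MemH (α / 2) v) : weinstein α (fun x => a * v (b * x)) = weinstein α v := by
  have hkinetic := integral_norm_fracD_sq_const_mul_comp_mul (by linarith : 0 ≤ α / 2) a hb hv
  have hpow : ∀ n : ℕ, ∫ x, |a * v (b * x)| ^ n = a ^ n * (b⁻¹ * ∫ x, |v x| ^ n) := fun n => by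
    simp only [abs_mul, abs_of_pos ha, mul_pow]
    rw [integral_const_mul, integral_comp_mul_pos hb (fun x => |v x| ^ n)]
  have hE : 0 ≤ ∫ x, ‖fracD (α / 2) v x‖ ^ 2 := by positivity
  have hN : 0 ≤ ∫ x, |v x| ^ 2 := by positivity
  rw [weinstein, weinstein, hkinetic, hpow, hpow]
  generalize (∫ x, ‖fracD (α / 2) v x‖ ^ 2) = E at *
  generalize (∫ x, |v x| ^ 2) = N at *
  generalize (∫ x, |v x| ^ 3) = C
  have hexp : (a ^ 2 * (b ^ (α / 2)) ^ 2 * b⁻¹) ^ (1 / (2 * α)) *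
      (a ^ 2 * b⁻¹) ^ (1 / (2 * α) * (α - 1) + 1) = a ^ 3 * b⁻¹ := by
    obtain ⟨x, rfl⟩ : ∃ x, Real.exp x = a := ⟨_, Real.exp_log ha⟩
    obtain ⟨y, rfl⟩ : ∃ y, Real.exp y = b := ⟨_, Real.exp_log hb⟩
    simp only [← Real.exp_nat_mul, ← Real.exp_neg, ← Real.exp_mul, ← Real.exp_add]
    congr 1
    push_cast
    field_simp
    ring
  rw [← mul_assoc, ← mul_assoc, ← mul_assoc, Real.mul_rpow (by positivity) hE,
    Real.mul_rpow (by positivity) hN, mul_mul_mul_comm, hexp,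
    mul_div_mul_left _ _ (by positivity)]

lemma Solves.weinstein_eq (hα : 1 / 3 < α) {Ψ : ℝ → ℝ} (h : Solves α 1 1 Ψ)
    (hpos : ∀ᵐ x, 0 < Ψ x) (hmass : 0 < ∫ x, Ψ x ^ 2) :
    weinstein α Ψ = (3 * α - 1) / (3 * α * (3 * α - 1) ^ (1 / (2 * α))) * √(∫ x, Ψ x ^ 2) := by
  have : 0 < α := by linarith
  have hq : 0 < 3 * α - 1 := by linarith
  obtain ⟨-, hkinetic, hcube⟩ := h.memH_and_integral_identities hα one_pos
  have habs : ∫ x, |Ψ x| ^ 3 = ∫ x, Ψ x ^ 3 :=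
    integral_congr_ae (hpos.mono fun x hx => by simp only [abs_of_pos hx])
  simp only [weinstein, sq_abs]
  rw [one_mul] at hkinetic hcube
  rw [habs, ← hcube, eq_div_of_mul_eq hq.ne' ((mul_comm _ _).trans hkinetic)]
  generalize ∫ x, Ψ x ^ 2 = N at *
  have hexp : N ^ (1 / (2 * α)) * N ^ (1 / (2 * α) * (α - 1) + 1) = N * √N := by
    rw [← Real.rpow_add hmass, Real.sqrt_eq_rpow]
    nth_rw 2 [← Real.rpow_one N]
    rw [← Real.rpow_add hmass]
    congr 1
    field_simp
    ring
  rw [Real.div_rpow hmass.le hq.le, div_mul_eq_mul_div, hexp]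
  field_simp

end Weinstein

end FBBM

end

noncomputable section

namespace FBBM

open Filter Topology

section Profiles

variable {α c : ℝ} {ψ : ℝ → ℝ}

lemma one_sub_inv_pos (hc : 1 < c) : 0 < 1 - 1 / c :=
  sub_pos.2 ((div_lt_one (one_pos.trans hc)).2 hc)

lemma div_sub_one_pos (hc : 1 < c) : 0 < c / (c - 1) :=
  div_pos (one_pos.trans hc) (sub_pos.2 hc)

lemma isProfile_iff_solves_rescale (hα : 0 < α) (hc : 1 < c) :
    IsProfile α c ψ ↔ Solves α 1 1 (rescale α c ψ) := by
  have hc1 : c - 1 ≠ 0 := (sub_pos.2 hc).ne'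
  have hc0 : c ≠ 0 := (one_pos.trans hc).ne'
  have hb : 0 < (c / (c - 1)) ^ (1 / α) := Real.rpow_pos_of_pos (div_sub_one_pos hc) _
  have hbα : ((c / (c - 1)) ^ (1 / α)) ^ α = c / (c - 1) := by
    rw [one_div, Real.rpow_inv_rpow (div_sub_one_pos hc).le hα.ne']
  constructor <;> intro h
  · have hscaled := h.const_mul_comp_mul hα.le (one_div_ne_zero hc1) hb
    rw [hbα] at hscaled
    convert hscaled using 1
    · field_simp
    · field_simp
    · rfl
  · have hscaled := h.const_mul_comp_mul hα.le hc1 (inv_pos.2 hb)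
    rw [Real.inv_rpow hb.le, hbα] at hscaled
    unfold IsProfile
    convert hscaled using 1
    · field_simp
    · field_simp
    · ext x
      rw [rescale, mul_inv_cancel_left₀ hb.ne']
      field_simp

lemma integral_rescale_sq (hc : 1 < c) :
    ∫ x, rescale α c ψ x ^ 2 =
      1 / (c - 1) ^ 2 * ((c / (c - 1)) ^ (1 / α))⁻¹ * ∫ x, ψ x ^ 2 := by
  simp only [rescale, mul_pow]
  rw [integral_const_mul, integral_comp_mul_pos (Real.rpow_pos_of_pos (div_sub_one_pos hc) _)
    (fun x => ψ x ^ 2), div_pow, one_pow, mul_assoc]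

/-- Twice the momentum of the profile with speed `c` whose rescaling has unit `L²` norm. -/
def speedFactor (α c : ℝ) : ℝ :=
  1 / (3 * α - 1) * c ^ (1 / α - 1) * (c - 1) ^ (3 - 1 / α) + c ^ (1 / α) * (c - 1) ^ (2 - 1 / α)

lemma IsProfile.two_mul_momentum_eq (hα : 1 / 3 < α) (hc : 1 < c) (h : IsProfile α c ψ) :
    2 * momentum α ψ = speedFactor α c * ∫ x, rescale α c ψ x ^ 2 := by
  obtain ⟨hH, hkinetic, -⟩ := h.memH_and_integral_identities hα (one_sub_inv_pos hc)
  have hc1 : 0 < c - 1 := sub_pos.2 hc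
  have hc0 : 0 < c := one_pos.trans hc
  have hq : 0 < 3 * α - 1 := by linarith
  rw [two_mul_momentum (by linarith) hH, integral_rescale_sq hc,
    eq_div_of_mul_eq hq.ne' ((mul_comm _ _).trans hkinetic), speedFactor,
    Real.div_rpow hc0.le hc1.le, Real.rpow_sub hc0, Real.rpow_sub hc1, Real.rpow_sub hc1,
    Real.rpow_one, Real.rpow_ofNat, Real.rpow_ofNat]
  field_simp

end Profiles

section Threshold

variable {α c : ℝ}

lemma quadratic_eq_sq_sub_sq (hα : 1 / 3 < α) (r : ℝ) :
    6 * α ^ 2 * r ^ 2 - 4 * α * r + 1 - α = ((6 * α * r - 2) ^ 2 - √(2 * (3 * α - 1)) ^ 2) / 6 := by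
  rw [Real.sq_sqrt (by linarith)]
  ring

lemma isGreatest_c₀ (hα : 1 / 3 < α) :
    IsGreatest {r : ℝ | 6 * α ^ 2 * r ^ 2 - 4 * α * r + 1 - α = 0} (c₀ α) := by
  have : 0 < α := by linarith
  constructor
  · rw [mem_ofPred_eq, quadratic_eq_sq_sub_sq hα, c₀, mul_div_cancel₀ _ (by positivity)]
    ring
  · intro r hr
    rw [mem_ofPred_eq, quadratic_eq_sq_sub_sq hα, div_eq_zero_iff, or_iff_left (by norm_num),
      sub_eq_zero] at hr
    rw [c₀, le_div_iff₀ (by positivity)]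
    have := le_of_abs_le (le_of_eq ((sq_eq_sq_iff_abs_eq_abs _ _).1 hr))
    rw [abs_of_nonneg (Real.sqrt_nonneg _)] at this
    linarith

lemma one_lt_c₀ (hα : 1 / 3 < α) (h : α < 1 / 2) : 1 < c₀ α := by
  rw [c₀, one_lt_div (by linarith)]
  have : 6 * α - 2 < √(2 * (3 * α - 1)) := Real.lt_sqrt_of_sq_lt (by nlinarith)
  linarith

lemma c₀_le_one (h : 1 / 2 ≤ α) : c₀ α ≤ 1 := by
  rw [c₀, div_le_one (by linarith)]
  have : √(2 * (3 * α - 1)) ≤ 6 * α - 2 := Real.sqrt_le_iff.2 ⟨by linarith, by nlinarith⟩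
  linarith

lemma quadratic_pos_of_c₀_lt (hα : 1 / 3 < α) (h : c₀ α < c) :
    0 < 6 * α ^ 2 * c ^ 2 - 4 * α * c + 1 - α := by
  rw [quadratic_eq_sq_sub_sq hα]
  rw [c₀, div_lt_iff₀ (by linarith)] at h
  have : √(2 * (3 * α - 1)) ^ 2 < (6 * α * c - 2) ^ 2 :=
    pow_lt_pow_left₀ (by linarith) (Real.sqrt_nonneg _) two_ne_zero
  linarith

lemma quadratic_neg_of_lt_c₀ (hα : 1 / 3 < α) (hc : 1 < c) (h : c < c₀ α) :
    6 * α ^ 2 * c ^ 2 - 4 * α * c + 1 - α < 0 := by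
  rw [quadratic_eq_sq_sub_sq hα]
  rw [c₀, lt_div_iff₀ (by linarith)] at h
  have : (6 * α * c - 2) ^ 2 < √(2 * (3 * α - 1)) ^ 2 :=
    pow_lt_pow_left₀ (by linarith) (by nlinarith) two_ne_zero
  linarith

lemma exists_pos_hasDerivAt_speedFactor (hα : 1 / 3 < α) (hc : 1 < c) :
    ∃ w, 0 < w ∧
      HasDerivAt (speedFactor α) (w * (6 * α ^ 2 * c ^ 2 - 4 * α * c + 1 - α)) c := by
  have hc0 : 0 < c := one_pos.trans hc
  have hc1 : 0 < c - 1 := sub_pos.2 hc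
  have hq : 0 < 3 * α - 1 := by linarith
  have : 0 < α := by linarith
  have hpow (p : ℝ) : HasDerivAt (fun c : ℝ => c ^ p) (p * c ^ (p - 1)) c :=
    Real.hasDerivAt_rpow_const (Or.inl hc0.ne')
  have hpow_sub (p : ℝ) : HasDerivAt (fun c : ℝ => (c - 1) ^ p) (1 * p * (c - 1) ^ (p - 1)) c :=
    ((hasDerivAt_id c).sub_const 1).rpow_const (Or.inl hc1.ne')
  refine ⟨c ^ (1 / α) / c ^ 2 * ((c - 1) / (c - 1) ^ (1 / α)) / (α * (3 * α - 1)), by positivity,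
    ((((hpow (1 / α - 1)).const_mul (1 / (3 * α - 1))).mul (hpow_sub (3 - 1 / α))).add
      ((hpow (1 / α)).mul (hpow_sub (2 - 1 / α)))).congr_deriv ?_⟩
  simp only [Real.rpow_sub hc0, Real.rpow_sub hc1, Real.rpow_one, Real.rpow_ofNat]
  have hX : 0 < c ^ (1 / α) := by positivity
  have hY : 0 < (c - 1) ^ (1 / α) := by positivity
  generalize c ^ (1 / α) = X at *
  generalize (c - 1) ^ (1 / α) = Y at *
  field_simp
  ring

lemma hasMomentumSigns_of_eq_speedFactor {N : ℝ} (hα : 1 / 3 < α) (hN : 0 < N) {M : ℝ → ℝ}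
    (hM : ∀ c, 1 < c → 2 * M c = speedFactor α c * N) : HasMomentumSigns α M := by
  have hderiv : ∀ c, 1 < c → ∃ w, 0 < w ∧
      HasDerivAt M (w * (6 * α ^ 2 * c ^ 2 - 4 * α * c + 1 - α)) c := fun c hc => by
    obtain ⟨w, hw, hd⟩ := exists_pos_hasDerivAt_speedFactor hα hc
    refine ⟨w * (N / 2), by positivity, ((hd.mul_const (N / 2)).congr_of_eventuallyEq
      ?_).congr_deriv (by ring)⟩
    filter_upwards [lt_mem_nhds hc] with x hx
    linarith [hM x hx]
  refine ⟨fun c hc => ?_, fun h c hc => ?_, fun h c hc => ?_, fun _ c hc hc' => ?_⟩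
  · obtain ⟨w, -, hd⟩ := hderiv c hc
    exact hd.differentiableAt
  · obtain ⟨w, hw, hd⟩ := hderiv c hc
    exact hd.deriv ▸ mul_pos hw (quadratic_pos_of_c₀_lt hα ((c₀_le_one h).trans_lt hc))
  · obtain ⟨w, hw, hd⟩ := hderiv c ((one_lt_c₀ hα h).trans hc)
    exact hd.deriv ▸ mul_pos hw (quadratic_pos_of_c₀_lt hα hc)
  · obtain ⟨w, hw, hd⟩ := hderiv c hc
    exact hd.deriv ▸ mul_neg_of_pos_of_neg hw (quadratic_neg_of_lt_c₀ hα hc hc')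

end Threshold

section Families

variable {α : ℝ}

lemma integral_sq_pos {X : Type*} [MeasurableSpace X] {μ : Measure X} {u : X → ℝ}
    (hu : MemLp u 2 μ) (h0 : ¬ ∀ᵐ x ∂μ, u x = 0) : 0 < ∫ x, u x ^ 2 ∂μ := by
  refine (integral_nonneg fun x => sq_nonneg _).lt_of_ne' fun hzero => h0 ?_
  refine ((integral_eq_zero_iff_of_nonneg (fun x => sq_nonneg (u x)) hu.integrable_sq).1
    hzero).mono fun x hx => ?_
  exact pow_eq_zero_iff two_ne_zero |>.1 hx

lemma not_ae_eq_zero_of_ae_pos {X : Type*} [MeasurableSpace X] {μ : Measure X} [NeZero μ]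
    {u : X → ℝ} (h : ∀ᵐ x ∂μ, 0 < u x) : ¬ ∀ᵐ x ∂μ, u x = 0 := fun h0 => by
  obtain ⟨x, hpos, hzero⟩ := (h.and h0).exists
  exact hpos.ne' hzero

lemma hasMomentumSigns_of_integral_rescale_sq_eq {ψ : ℝ → ℝ → ℝ} {N : ℝ} (hα : 1 / 3 < α)
    (hψ : ∀ c, 1 < c → IsProfile α c (ψ c)) (hN : 0 < N)
    (hmass : ∀ c, 1 < c → ∫ x, rescale α c (ψ c) x ^ 2 = N) :
    HasMomentumSigns α (fun c => momentum α (ψ c)) :=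
  hasMomentumSigns_of_eq_speedFactor hα hN fun c hc => by
    rw [(hψ c hc).two_mul_momentum_eq hα hc, hmass c hc]

lemma hasMomentumSigns_of_translates {ψ : ℝ → ℝ → ℝ} {Ψ : ℝ → ℝ} (hα : 1 / 3 < α)
    (hψ : ∀ c, 1 < c → IsProfile α c (ψ c))
    (hΨ : ∀ c, 1 < c → ∃ y : ℝ, ∀ᵐ x, rescale α c (ψ c) x = Ψ (x + y))
    (h0 : ¬ ∀ᵐ x, Ψ x = 0) : HasMomentumSigns α (fun c => momentum α (ψ c)) := by
  have hmemLp : MemLp Ψ 2 volume := by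
    obtain ⟨y, hy⟩ := hΨ 2 one_lt_two
    have htranslate := measurePreserving_sub_right (volume : Measure ℝ) y
    have hR := ((isProfile_iff_solves_rescale (by linarith) one_lt_two).1
      (hψ 2 one_lt_two)).memLp_real
    refine (hR.comp_measurePreserving htranslate).ae_eq ?_
    filter_upwards [htranslate.quasiMeasurePreserving.ae hy] with x hx
    rw [Function.comp_apply, hx, sub_add_cancel]
  refine hasMomentumSigns_of_integral_rescale_sq_eq hα hψ (integral_sq_pos hmemLp h0)
    fun c hc => ?_
  obtain ⟨y, hy⟩ := hΨ c hc
  rw [← integral_add_right_eq_self (fun x => Ψ x ^ 2) y]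
  exact integral_congr_ae (hy.mono fun x hx => by simp only [hx])

variable {c : ℝ} {φ : ℝ → ℝ}

lemma IsGroundState.rescale_pos (hc : 1 < c) (h : IsGroundState α c φ) :
    ∀ᵐ x, 0 < rescale α c φ x := by
  filter_upwards [ae_comp_mul (Real.rpow_pos_of_pos (div_sub_one_pos hc) (1 / α)).ne' h.2.2.1]
    with x hx
  exact mul_pos (one_div_pos.2 (sub_pos.2 hc)) hx

lemma IsGroundState.integral_rescale_sq_pos (hα : 0 < α) (hc : 1 < c) (h : IsGroundState α c φ) :
    0 < ∫ x, rescale α c φ x ^ 2 :=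
  integral_sq_pos ((isProfile_iff_solves_rescale hα hc).1 h.1).memLp_real
    (not_ae_eq_zero_of_ae_pos (h.rescale_pos hc))

lemma IsGroundState.weinstein_eq (hα : 1 / 3 < α) (hc : 1 < c) (h : IsGroundState α c φ) :
    weinstein α φ = (3 * α - 1) / (3 * α * (3 * α - 1) ^ (1 / (2 * α))) *
      √(∫ x, rescale α c φ x ^ 2) := by
  have hα0 : 0 < α := by linarith
  rw [← ((isProfile_iff_solves_rescale hα0 hc).1 h.1).weinstein_eq hα (h.rescale_pos hc)
    (h.integral_rescale_sq_pos hα0 hc)]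
  exact (weinstein_const_mul_comp_mul hα0 (one_div_pos.2 (sub_pos.2 hc))
    (Real.rpow_pos_of_pos (div_sub_one_pos hc) _) h.1.1).symm

lemma IsGroundState.integral_rescale_sq_eq {c' : ℝ} {φ' : ℝ → ℝ} (hα : 1 / 3 < α) (hc : 1 < c)
    (hc' : 1 < c') (h : IsGroundState α c φ) (h' : IsGroundState α c' φ') :
    ∫ x, rescale α c φ x ^ 2 = ∫ x, rescale α c' φ' x ^ 2 := by
  have hq : 0 < 3 * α - 1 := by linarith
  have : 0 < α := by linarith
  have hJ : weinstein α φ = weinstein α φ' :=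
    (h.2.2.2 φ' h'.1.1 (not_ae_eq_zero_of_ae_pos h'.2.2.1)).antisymm
      (h'.2.2.2 φ h.1.1 (not_ae_eq_zero_of_ae_pos h.2.2.1))
  rw [h.weinstein_eq hα hc, h'.weinstein_eq hα hc'] at hJ
  exact (Real.sqrt_inj (by positivity) (by positivity)).1 (mul_left_cancel₀ (by positivity) hJ)

lemma hasMomentumSigns_of_isGroundState {φ : ℝ → ℝ → ℝ} (hα : 1 / 3 < α)
    (h : ∀ c, 1 < c → IsGroundState α c (φ c)) :
    HasMomentumSigns α (fun c => momentum α (φ c)) :=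
  hasMomentumSigns_of_integral_rescale_sq_eq hα (fun c hc => (h c hc).1)
    ((h 2 one_lt_two).integral_rescale_sq_pos (by linarith) one_lt_two) fun c hc =>
      (h c hc).integral_rescale_sq_eq hα hc one_lt_two (h 2 one_lt_two)

end Families

end FBBM

end

theorem mainTheorem10_general (α : ℝ) (hα : 1 / 3 < α) :
    (∀ c : ℝ, 1 < c → ∀ ψ : ℝ → ℝ,
      FBBM.IsProfile α c ψ ↔ FBBM.Solves α 1 1 (FBBM.rescale α c ψ)) ∧
    (∀ c : ℝ, 1 < c → ∀ ψ : ℝ → ℝ, FBBM.IsProfile α c ψ →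
      FBBM.MemH α ψ ∧
      2 * FBBM.momentum α ψ =
        (1 / (3 * α - 1) * c ^ (1 / α - 1) * (c - 1) ^ (3 - 1 / α)
          + c ^ (1 / α) * (c - 1) ^ (2 - 1 / α)) * ∫ x, FBBM.rescale α c ψ x ^ 2) ∧
    IsGreatest {r : ℝ | 6 * α ^ 2 * r ^ 2 - 4 * α * r + 1 - α = 0} (FBBM.c₀ α) ∧
    (α < 1 / 2 → 1 < FBBM.c₀ α) ∧
    (∀ (ψ : ℝ → ℝ → ℝ) (Ψ : ℝ → ℝ),
      (∀ c : ℝ, 1 < c → FBBM.IsProfile α c (ψ c)) →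
      (∀ c : ℝ, 1 < c → ∃ y : ℝ, ∀ᵐ x : ℝ, FBBM.rescale α c (ψ c) x = Ψ (x + y)) →
      ¬ (∀ᵐ x : ℝ, Ψ x = 0) →
      FBBM.HasMomentumSigns α (fun c => FBBM.momentum α (ψ c))) ∧
    (∀ Φ : ℝ → ℝ → ℝ,
      (∀ c : ℝ, 1 < c → FBBM.IsGroundState α c (Φ c)) →
      FBBM.HasMomentumSigns α (fun c => FBBM.momentum α (Φ c))) :=
  have hα0 : 0 < α := by linarith
  ⟨fun _ hc _ => FBBM.isProfile_iff_solves_rescale hα0 hc,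
    fun _ hc _ h => ⟨(h.memH_and_integral_identities hα (FBBM.one_sub_inv_pos hc)).1,
      h.two_mul_momentum_eq hα hc⟩,
    FBBM.isGreatest_c₀ hα, FBBM.one_lt_c₀ hα,
    fun _ _ => FBBM.hasMomentumSigns_of_translates hα,
    fun _ => FBBM.hasMomentumSigns_of_isGroundState hα⟩

theorem mainTheorem10 (α : ℝ) (hα₁ : 1 / 3 < α) (hα₂ : α < 1) :
    -- the scaling maps profiles with speed `c` exactly onto solutions of `D^α Ψ + Ψ - Ψ² = 0`
    (∀ c : ℝ, 1 < c → ∀ ψ : ℝ → ℝ,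
      FBBM.IsProfile α c ψ ↔ FBBM.Solves α 1 1 (FBBM.rescale α c ψ)) ∧
    -- the momentum is well defined and given by the formula
    (∀ c : ℝ, 1 < c → ∀ ψ : ℝ → ℝ, FBBM.IsProfile α c ψ →
      FBBM.MemH α ψ ∧
      2 * FBBM.momentum α ψ =
        (1 / (3 * α - 1) * c ^ (1 / α - 1) * (c - 1) ^ (3 - 1 / α)
          + c ^ (1 / α) * (c - 1) ^ (2 - 1 / α)) * ∫ x, FBBM.rescale α c ψ x ^ 2) ∧
    -- the threshold speed
    IsGreatest {r : ℝ | 6 * α ^ 2 * r ^ 2 - 4 * α * r + 1 - α = 0} (FBBM.c₀ α) ∧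
    (α < 1 / 2 → 1 < FBBM.c₀ α) ∧
    -- families of profiles that come from one nontrivial `Ψ`, up to translations
    (∀ (ψ : ℝ → ℝ → ℝ) (Ψ : ℝ → ℝ),
      (∀ c : ℝ, 1 < c → FBBM.IsProfile α c (ψ c)) →
      (∀ c : ℝ, 1 < c → ∃ y : ℝ, ∀ᵐ x : ℝ, FBBM.rescale α c (ψ c) x = Ψ (x + y)) →
      ¬ (∀ᵐ x : ℝ, Ψ x = 0) →
      FBBM.HasMomentumSigns α (fun c => FBBM.momentum α (ψ c))) ∧
    -- families of ground states
    (∀ Φ : ℝ → ℝ → ℝ,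
      (∀ c : ℝ, 1 < c → FBBM.IsGroundState α c (Φ c)) →
      FBBM.HasMomentumSigns α (fun c => FBBM.momentum α (Φ c))) :=
  mainTheorem10_general α hα₁
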